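/- Consider the nearest-neighbour Ising model on $\mathbb{Z}^2$ with Hamiltonian $\mathbf{H}=-\sum_{\{x,y\}}S_xS_y$ and zero external field. Let $\beta_c$ be the critical inverse temperature, i.e. the infimum of those $\beta\ge 0$ for which the infinite-volume Gibbs distribution is not unique. For finite $\Lambda\subset\mathbb{Z}^2$ let $\langle\cdot\rangle_{\Lambda}$ be the Ising model in $\Lambda$ at $\beta_c$ with free boundary condition. As $\Lambda\uparrow\mathbb{Z}^2$, these measures converge weakly to an infinite-volume limit $\langle\cdot\rangle_c$, the critical Ising model (outside $\Lambda$ the spins may be taken as independent symmetric signs). Put $\tau_c(z)=\langle S_0S_z\rangle_c$. Let $P$ be the corresponding critical FK measure on bond configurations of $\mathbb{Z}^2$: given the critical Ising spins, each bond whose endpoints carry equal spins is open with probability $p_c=1-e^{-2\beta_c}$, independently, and all other bonds are closed. For $r\ge 0$ let $B(r)=\{y\in\mathbb{Z}^2:\|y\|\le r\}$, where $\|\cdot\|$ is the Euclidean norm, and let $\partial B(r)$ be the set of sites of $B(r)$ having a nearest neighbour outside $B(r)$. Let $P^W_{\partial B(r)}$ be the critical FK measure inside $B(r)$ with wired boundary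 condition on $\partial B(r)$, i.e. the probability measure on configurations $\omega$ of open bonds among the bonds with both ends in $B(r)$ that gives $\omega$ a weight proportional to $p_c^{o(\omega)}(1-p_c)^{c(\omega)}2^{k(\omega)}$, where $o(\omega)$ and $c(\omega)$ are the numbers of open and closed bonds and $k(\omega)$ is the number of clusters in $B(r)$ when all sites of $\partial B(r)$ are regarded as connected to each other. Write $0\leftrightarrow\partial B(r)$ for the event that $0$ is joined to some site of $\partial B(r)$ by a path of open bonds (a path of length $0$ being allowed). Then for all $x,y\in\mathbb{Z}^2$, with $r=\|x-y\|/3$, $$\tau_c(y-x)\;\le\;P^W_{\partial B(r)}\bigl(0\leftrightarrow\partial B(r)\bigr)\;P\bigl(0\leftrightarrow\partial B(r)\bigr).$$ -/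

import Mathlib

open MeasureTheory ProbabilityTheory Filter Topology

namespace IsingFK

noncomputable section

/-! The square lattice. -/

/-- The sites of the square lattice. -/
abbrev Z2 : Type := ℤ × ℤ

/-- The Euclidean norm of a site. -/
def eNorm (z : Z2) : ℝ := Real.sqrt ((z.1 : ℝ) ^ 2 + (z.2 : ℝ) ^ 2)

/-- The nearest-neighbour graph on the square lattice. -/
def lattice : SimpleGraph Z2 where
  Adj x y := |x.1 - y.1| + |x.2 - y.2| = 1
  symm := ⟨fun x y h => by rw [abs_sub_comm y.1, abs_sub_comm y.2]; exact h⟩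
  loopless := ⟨fun x h => by simp at h⟩

/-- A bond is an unordered pair of neighbouring sites. These are the bonds with both ends in a
finite set of sites. -/
def bondsIn (Λ : Finset Z2) : Finset (Sym2 Z2) := by
  classical exact Λ.sym2.filter (· ∈ lattice.edgeSet)

/-- The bonds with at least one end in a finite set of sites. -/
def bondsTouching (Λ : Finset Z2) : Finset (Sym2 Z2) :=
  Λ.biUnion fun z =>
    {s(z, z + (1, 0)), s(z, z - (1, 0)), s(z, z + (0, 1)), s(z, z - (0, 1))}

/-! The Ising model at zero external field. -/

/-- Spin configurations; `true` stands for the spin `+1` and `false` for the spin `-1`. -/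
abbrev Spins : Type := Z2 → Bool

/-- The value `±1` of the spin at the site `z`. -/
def spin (σ : Spins) (z : Z2) : ℝ := if σ z then 1 else -1

/-- The product of the two spins at the ends of a bond. -/
def bondSpin (σ : Spins) (e : Sym2 Z2) : ℝ := (e.map (spin σ)).mul

/-- Independent symmetric spins. -/
def fairSpins : Measure Spins :=
  Measure.infinitePi fun _ : Z2 => bernoulliMeasure true false ⟨1 / 2, by norm_num, by norm_num⟩

instance : IsProbabilityMeasure fairSpins := by unfold fairSpins; infer_instance

/-- The configuration that is `σ` inside `Λ` and `τ` outside. -/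
def glue (Λ : Finset Z2) (τ σ : Spins) : Spins := fun z => if z ∈ Λ then σ z else τ z

/-- The finite-volume Gibbs distribution in `Λ` at inverse temperature `β` with boundary
condition `τ`: the law with density proportional to `exp (β ∑ S_x S_y)`, the sum running over all
bonds with an end in `Λ`, with respect to the uniform distribution on the configurations that
agree with `τ` outside `Λ`. -/
def gibbsKernel (β : ℝ) (Λ : Finset Z2) (τ : Spins) : Measure Spins :=
  (fairSpins.map (glue Λ τ)).tilted fun σ => β * ∑ e ∈ bondsTouching Λ, bondSpin σ e

/-- Infinite-volume Gibbs distributions (the Dobrushin-Lanford-Ruelle equations). -/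
def IsGibbs (β : ℝ) (μ : ProbabilityMeasure Spins) : Prop :=
  ∀ (Λ : Finset Z2) (A : Set Spins), MeasurableSet A →
    ∫⁻ τ, gibbsKernel β Λ τ A ∂(μ : Measure Spins) = (μ : Measure Spins) A

/-- The critical inverse temperature: the threshold for nonuniqueness of the infinite-volume Gibbs
distribution. -/
def betaC : ℝ :=
  sInf {β : ℝ | 0 ≤ β ∧ ∃ μ ν : ProbabilityMeasure Spins, IsGibbs β μ ∧ IsGibbs β ν ∧ μ ≠ ν}

lemma betaC_nonneg : 0 ≤ betaC := Real.sInf_nonneg fun _ h => h.1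

lemma measurable_spin (z : Z2) : Measurable fun σ : Spins => spin σ z :=
  (measurable_from_top (f := fun b : Bool => if b then (1 : ℝ) else -1)).comp
    (measurable_pi_apply z)

lemma measurable_bondSpin (e : Sym2 Z2) : Measurable fun σ : Spins => bondSpin σ e := by
  induction e using Sym2.ind with
  | _ x y => exact (measurable_spin x).mul (measurable_spin y)

lemma abs_bondSpin_le (σ : Spins) (e : Sym2 Z2) : |bondSpin σ e| ≤ 1 := by
  induction e using Sym2.ind with
  | _ x y =>
    simp only [bondSpin, Sym2.map_mk, Sym2.mul_mk, spin]
    split_ifs <;> simp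

/-- The Ising model on the finite set `Λ` with free boundary condition, extended by independent
symmetric spins outside `Λ`. -/
def isingFree (β : ℝ) (Λ : Finset Z2) : ProbabilityMeasure Spins :=
  ⟨fairSpins.tilted fun σ => β * ∑ e ∈ bondsIn Λ, bondSpin σ e, by
    apply isProbabilityMeasure_tilted
    have hm : Measurable fun σ : Spins => Real.exp (β * ∑ e ∈ bondsIn Λ, bondSpin σ e) :=
      ((Finset.measurable_sum _ fun e _ => measurable_bondSpin e).const_mul β).exp
    refine Integrable.of_bound hm.aestronglyMeasurable
      (Real.exp (|β| * (bondsIn Λ).card)) (Eventually.of_forall fun σ => ?_)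
    rw [Real.norm_eq_abs, Real.abs_exp, Real.exp_le_exp]
    refine (le_abs_self _).trans ?_
    rw [abs_mul]
    refine mul_le_mul_of_nonneg_left ?_ (abs_nonneg β)
    refine (Finset.abs_sum_le_sum_abs _ _).trans ?_
    simpa using Finset.sum_le_sum fun e (_ : e ∈ bondsIn Λ) => abs_bondSpin_le σ e⟩

/-- The critical Ising model in infinite volume: the limit, in the topology of weak convergence on
the compact product space of spin configurations, of the free-boundary models at `betaC` along the
net of all finite sets of sites ordered by inclusion. -/
def criticalIsing : ProbabilityMeasure Spins := limUnder atTop (isingFree betaC)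

/-- The critical two-point correlation at displacement `z`. -/
def tau (z : Z2) : ℝ := ∫ σ, spin σ 0 * spin σ z ∂(criticalIsing : Measure Spins)

/-! The FK representation. -/

/-- The critical bond density `1 - exp (-2 β_c)`. -/
def pC : unitInterval :=
  ⟨1 - Real.exp (-2 * betaC), by
    constructor
    · have h : Real.exp (-2 * betaC) ≤ 1 :=
        Real.exp_le_one_iff.2 (by have := betaC_nonneg; linarith)
      linarith
    · have := Real.exp_pos (-2 * betaC)
      linarith⟩

/-- Bond configurations, given by their sets of open bonds. -/
abbrev Bonds : Type := Set (Sym2 Z2)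

/-- The bonds of `ω` whose two ends carry equal spins. -/
def agreeing (σ : Spins) (ω : Bonds) : Bonds := {e | e ∈ ω ∧ bondSpin σ e = 1}

lemma measurable_agreeing : Measurable fun c : Spins × Bonds => agreeing c.1 c.2 := by
  rw [measurable_set_iff]
  intro e
  have h1 : MeasurableSet {c : Spins × Bonds | e ∈ c.2} :=
    measurableSet_setOfPred.2 ((measurable_set_mem e).comp measurable_snd)
  have h2 : MeasurableSet {c : Spins × Bonds | bondSpin c.1 e = 1} :=
    ((measurable_bondSpin e).comp measurable_fst) (measurableSet_singleton 1)
  exact measurableSet_setOfPred.1 (h1.inter h2)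

/-- The critical FK measure on the whole lattice: given the critical Ising spins, every bond with
equal spins at its ends is open with probability `pC`, independently, and all other bonds are
closed. -/
def criticalFK : Measure Bonds :=
  ((criticalIsing : Measure Spins).prod (setBernoulli lattice.edgeSet pC)).map
    fun c => agreeing c.1 c.2

/-- The site `x` is connected to the set of sites `A` by a path of open bonds. -/
def Connects (ω : Bonds) (x : Z2) (A : Set Z2) : Prop :=
  ∃ v ∈ A, (SimpleGraph.fromEdgeSet ω).Reachable x v

lemma finite_eNorm_le (r : ℝ) : {z : Z2 | eNorm z ≤ r}.Finite := by
  refine (Set.finite_Icc ((-⌈r⌉, -⌈r⌉) : Z2) (⌈r⌉, ⌈r⌉)).subset fun z hz => ?_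
  have h1 : |(z.1 : ℝ)| ≤ r :=
    (Real.abs_le_sqrt (by nlinarith [sq_nonneg (z.2 : ℝ)])).trans hz
  have h2 : |(z.2 : ℝ)| ≤ r :=
    (Real.abs_le_sqrt (by nlinarith [sq_nonneg (z.1 : ℝ)])).trans hz
  have h3 := abs_le.1 (h1.trans (Int.le_ceil r))
  have h4 := abs_le.1 (h2.trans (Int.le_ceil r))
  exact ⟨⟨by exact_mod_cast h3.1, by exact_mod_cast h4.1⟩,
    ⟨by exact_mod_cast h3.2, by exact_mod_cast h4.2⟩⟩

/-- The disc `B(r)` of sites at Euclidean distance at most `r` from the origin. -/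
def disc (r : ℝ) : Finset Z2 := (finite_eNorm_le r).toFinset

/-- The lattice boundary of `B`: the sites of `B` that have a neighbour outside `B`. -/
def bdry (B : Finset Z2) : Set Z2 := {v | v ∈ B ∧ ∃ w, w ∉ B ∧ lattice.Adj v w}

/-- The number of clusters in `B` of the configuration `ω` when all the boundary sites of `B` are
regarded as connected to each other. -/
def wiredClusters (B : Finset Z2) (ω : Finset (Sym2 Z2)) : ℕ :=
  Nat.card ((SimpleGraph.fromEdgeSet ((ω : Set (Sym2 Z2)) ∪ {e | ∀ v ∈ e, v ∈ bdry B})).induce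
    (B : Set Z2)).ConnectedComponent

/-- The critical FK weight of a bond configuration in `B` with wired boundary condition. -/
def wiredWeight (B : Finset Z2) (ω : Finset (Sym2 Z2)) : ℝ := by
  classical exact
    (pC : ℝ) ^ ω.card * (1 - (pC : ℝ)) ^ (bondsIn B \ ω).card * 2 ^ wiredClusters B ω

/-- The probability of the event `A` under the critical FK measure inside `B` with wired boundary
condition on the boundary of `B`. -/
def wiredProb (B : Finset Z2) (A : Set Bonds) : ℝ := by
  classical exact
    (∑ ω ∈ (bondsIn B).powerset.filter (fun ω : Finset (Sym2 Z2) => (ω : Set (Sym2 Z2)) ∈ A),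
      wiredWeight B ω) /
      ∑ ω ∈ (bondsIn B).powerset, wiredWeight B ω

/-- The event that the origin is connected to the boundary of the disc `B(r)`. -/
def zeroToBdry (r : ℝ) : Set Bonds := {ω | Connects ω 0 (bdry (disc r))}

end

end IsingFK

/-! By translation one may take `x = 0` and `y = z`. In a finite volume `Λ` the Edwards-Sokal
coupling turns `⟨S_0 S_z⟩` into the FK probability that `0` and `z` are connected. With `r = |z| /
3` the discs of radius `r` about `0` and `z` are disjoint, so such a connection joins `0` to the
boundary of its disc inside that disc, and `z` to the boundary of the other disc inside that one.
Given the bonds not contained in the disc about `z`, which decide the first event, the second is at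
most as likely as under wired boundary conditions, by the FKG inequality. This gives the bound in
`Λ` (`rcSum_triv_mul_le`); its wired factor does not depend on `Λ`, and the other terms converge as
`Λ` grows.

Clusters are handled through the spins. The factor `2 ^ k(ω)` is, up to a constant, the probability
`mass ω` that fair spins agree along `ω`, and connection of two sites becomes triviality of the
character `S_x S_y` on the configurations that agree along `ω`. Orthogonality of characters
(`setIntegral_agreeSet`) then yields the effect of adding a bond (`mass_insert`), hence
log-supermodularity and FKG, and also the Edwards-Sokal formula. Comparison with the wired measure
(`rcSum_mul_le_wired`) is FKG applied to the density of the wired weight, which is increasing.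

The infinite-volume limit exists because correlations increase with the set of bonds (Griffiths,
again from FKG), the space of probability measures is compact, and correlations determine a measure.
-/

namespace IsingFK

noncomputable section

/-! Multiplicative functions of the spins. -/

/-- Pointwise multiplication of spin configurations. -/
def spinMul (τ σ : Spins) : Spins := fun z => τ z == σ z

lemma spin_spinMul (τ σ : Spins) (z : Z2) : spin (spinMul τ σ) z = spin τ z * spin σ z := by
  rcases Bool.eq_false_or_eq_true (τ z) with h | h <;>
    rcases Bool.eq_false_or_eq_true (σ z) with h' | h' <;> simp [spin, spinMul, h, h']

lemma spin_eq_or (σ : Spins) (z : Z2) : spin σ z = 1 ∨ spin σ z = -1 := by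
  simp only [spin]
  cases σ z <;> simp

/-- A measurable character, with values `±1`, of the group of spin configurations. -/
structure IsSpinChar (χ : Spins → ℝ) : Prop where
  measurable : Measurable χ
  map_mul : ∀ τ σ, χ (spinMul τ σ) = χ τ * χ σ
  eq_or : ∀ σ, χ σ = 1 ∨ χ σ = -1

lemma isSpinChar_spin (z : Z2) : IsSpinChar fun σ => spin σ z :=
  ⟨measurable_spin z, fun τ σ => spin_spinMul τ σ z, fun σ => spin_eq_or σ z⟩

lemma isSpinChar_one : IsSpinChar fun _ => 1 :=
  ⟨measurable_const, fun _ _ => by simp, fun _ => Or.inl rfl⟩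

lemma IsSpinChar.mul {χ ψ : Spins → ℝ} (hχ : IsSpinChar χ) (hψ : IsSpinChar ψ) :
    IsSpinChar fun σ => χ σ * ψ σ :=
  ⟨hχ.measurable.mul hψ.measurable,
    fun τ σ => by rw [hχ.map_mul, hψ.map_mul]; ring,
    fun σ => by rcases hχ.eq_or σ with h | h <;> rcases hψ.eq_or σ with h' | h' <;> simp [h, h']⟩

lemma isSpinChar_prod (A : Finset Z2) : IsSpinChar fun σ => ∏ z ∈ A, spin σ z := by
  classical
  induction A using Finset.induction_on with
  | empty => simpa using isSpinChar_one
  | insert a s ha ih => simpa [Finset.prod_insert ha] using (isSpinChar_spin a).mul ih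

@[simp]
lemma bondSpin_mk (σ : Spins) (x y : Z2) : bondSpin σ s(x, y) = spin σ x * spin σ y := rfl

lemma isSpinChar_bondSpin (e : Sym2 Z2) : IsSpinChar fun σ => bondSpin σ e := by
  induction e using Sym2.ind with
  | _ x y => exact (isSpinChar_spin x).mul (isSpinChar_spin y)

lemma bondSpin_mk_eq_one_iff (σ : Spins) (x y : Z2) : bondSpin σ s(x, y) = 1 ↔ σ x = σ y := by
  simp only [bondSpin_mk, spin]
  cases σ x <;> cases σ y <;> norm_num

lemma IsSpinChar.abs_eq {χ : Spins → ℝ} (hχ : IsSpinChar χ) (σ : Spins) : |χ σ| = 1 := by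
  rcases hχ.eq_or σ with h | h <;> simp [h]

lemma IsSpinChar.integrable {χ : Spins → ℝ} (hχ : IsSpinChar χ) (μ : Measure Spins)
    [IsFiniteMeasure μ] : Integrable χ μ :=
  Integrable.of_bound hχ.measurable.aestronglyMeasurable 1
    (Eventually.of_forall fun σ => (hχ.abs_eq σ).le)

lemma measurable_spinMul (τ : Spins) : Measurable (spinMul τ) :=
  measurable_pi_lambda _ fun z =>
    (measurable_from_top (f := fun b : Bool => τ z == b)).comp (measurable_pi_apply z)

lemma fairSpins_map_spinMul (τ : Spins) : fairSpins.map (spinMul τ) = fairSpins := by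
  have h := Measure.infinitePi_map_pi
    (μ := fun _ : Z2 => bernoulliMeasure true false ⟨1 / 2, by norm_num, by norm_num⟩)
    (f := fun z b => τ z == b) (fun z => measurable_from_top)
  refine h.trans ?_
  unfold fairSpins
  congr 1
  funext z
  ext s hs
  classical
  rw [Measure.map_apply measurable_from_top hs]
  -- Both atoms of a fair coin have the same weight, so flipping the coin preserves its law.
  have h2 : unitInterval.toNNReal (unitInterval.symm ⟨1 / 2, by norm_num, by norm_num⟩) =
      unitInterval.toNNReal ⟨1 / 2, by norm_num, by norm_num⟩ := by
    ext
    simp only [unitInterval.coe_toNNReal, unitInterval.coe_symm_eq]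
    norm_num
  cases hz : τ z
  · simp only [bernoulliMeasure_def, h2]
    simp [Measure.dirac_apply' _ hs, Measure.dirac_apply' _ (MeasurableSet.of_discrete
      (s := (fun b : Bool => !b) ⁻¹' s)), Set.indicator]
    exact add_comm _ _
  · simp

/-- Reindexing of the sites preserves the fair measure. -/
lemma fairSpins_map_comp (T : Z2 ≃ Z2) : fairSpins.map (fun σ z => σ (T z)) = fairSpins := by
  have h := Measure.infinitePi_map_piCongrLeft
    (μ := fun _ : Z2 => bernoulliMeasure true false ⟨1 / 2, by norm_num, by norm_num⟩) T.symm
  refine Eq.trans ?_ h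
  congr 1
  funext σ z
  rw [MeasurableEquiv.coe_piCongrLeft, Equiv.piCongrLeft_apply_eq_cast]
  simp

/-! The configurations in which the bonds of a given set agree. -/

/-- The spin configurations with equal spins at the ends of every bond in `ω`. -/
def agreeSet (ω : Finset (Sym2 Z2)) : Set Spins := {σ | ∀ e ∈ ω, bondSpin σ e = 1}

lemma mem_agreeSet {ω : Finset (Sym2 Z2)} {σ : Spins} :
    σ ∈ agreeSet ω ↔ ∀ e ∈ ω, bondSpin σ e = 1 := Iff.rfl

lemma agreeSet_anti {ω η : Finset (Sym2 Z2)} (h : ω ⊆ η) : agreeSet η ⊆ agreeSet ω :=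
  fun _ hσ e he => hσ e (h he)

lemma measurableSet_agreeSet (ω : Finset (Sym2 Z2)) : MeasurableSet (agreeSet ω) := by
  have : agreeSet ω = ⋂ e ∈ ω, {σ | bondSpin σ e = 1} := by ext; simp [agreeSet]
  rw [this]
  exact Finset.measurableSet_biInter _ fun e _ =>
    measurable_bondSpin e (measurableSet_singleton 1)

/-- `agreeSet ω` is a subgroup of the spin configurations under `spinMul`, being the common kernel
of the bond characters; it is therefore invariant under translation by its own elements. -/
lemma spinMul_mem_agreeSet_iff {ω : Finset (Sym2 Z2)} {τ σ : Spins} (hτ : τ ∈ agreeSet ω) :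
    spinMul τ σ ∈ agreeSet ω ↔ σ ∈ agreeSet ω := by
  refine forall₂_congr fun e he => ?_
  rw [(isSpinChar_bondSpin e).map_mul, hτ e he, one_mul]

/-- The probability that independent symmetric spins agree along all bonds of `ω`. It is equal to
`2` to the number of clusters of `ω` minus the number of sites. -/
def mass (ω : Finset (Sym2 Z2)) : ℝ := fairSpins.real (agreeSet ω)

lemma mass_nonneg (ω : Finset (Sym2 Z2)) : 0 ≤ mass ω := measureReal_nonneg

/-- The function `χ` is identically `1` on the configurations that agree along `ω`. -/
def Trivializes (χ : Spins → ℝ) (ω : Finset (Sym2 Z2)) : Prop := ∀ σ ∈ agreeSet ω, χ σ = 1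

lemma Trivializes.mono {χ : Spins → ℝ} {ω η : Finset (Sym2 Z2)} (h : ω ⊆ η)
    (hχ : Trivializes χ ω) : Trivializes χ η := fun σ hσ => hχ σ (agreeSet_anti h hσ)

open Classical in
/-- The indicator function of `Trivializes`. -/
def triv (χ : Spins → ℝ) (ω : Finset (Sym2 Z2)) : ℝ := if Trivializes χ ω then 1 else 0

lemma triv_nonneg (χ : Spins → ℝ) (ω : Finset (Sym2 Z2)) : 0 ≤ triv χ ω := by
  unfold triv; split_ifs <;> simp

lemma triv_mono (χ : Spins → ℝ) : Monotone (triv χ) := fun ω η h => by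
  unfold triv
  split_ifs with h1 h2
  · rfl
  · exact absurd (h1.mono h) h2
  · exact zero_le_one
  · rfl

/-- Equality may fail, since a product can be trivial when neither factor is. This direction is the
one that Griffiths' inequality needs. -/
lemma triv_mul_le (χ ψ : Spins → ℝ) (ω : Finset (Sym2 Z2)) :
    triv χ ω * triv ψ ω ≤ triv (fun σ => χ σ * ψ σ) ω := by
  by_cases h : Trivializes χ ω ∧ Trivializes ψ ω
  · have : Trivializes (fun σ => χ σ * ψ σ) ω := fun σ hσ => by simp [h.1 σ hσ, h.2 σ hσ]
    simp [triv, h.1, h.2, this]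
  · refine le_trans (le_of_eq ?_) (triv_nonneg _ _)
    rcases not_and_or.1 h with h | h <;> simp [triv, h]

/-- Orthogonality of characters on the subgroup `agreeSet ω`: if `χ τ = -1` for some `τ` in it,
translation by `τ` preserves the fair measure and the subgroup but changes the sign of the integral,
which must vanish. -/
lemma setIntegral_agreeSet {χ : Spins → ℝ} (hχ : IsSpinChar χ) (ω : Finset (Sym2 Z2)) :
    ∫ σ in agreeSet ω, χ σ ∂fairSpins = triv χ ω * mass ω := by
  by_cases h : Trivializes χ ω
  · rw [setIntegral_congr_fun (measurableSet_agreeSet ω) (g := fun _ => 1) h]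
    simp [triv, h, mass]
  · have h' := h
    simp only [Trivializes, not_forall] at h'
    obtain ⟨τ, hτ, hτ1⟩ := h'
    have hτ2 := (hχ.eq_or τ).resolve_left hτ1
    have key : ∫ σ in agreeSet ω, χ σ ∂fairSpins = -∫ σ in agreeSet ω, χ σ ∂fairSpins := by
      have h1 : ∫ σ, (agreeSet ω).indicator χ (spinMul τ σ) ∂fairSpins =
          ∫ σ, (agreeSet ω).indicator χ σ ∂fairSpins := by
        conv_rhs => rw [← fairSpins_map_spinMul τ]
        rw [integral_map (measurable_spinMul τ).aemeasurable
          (hχ.measurable.indicator (measurableSet_agreeSet ω)).aestronglyMeasurable]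
      rw [← integral_indicator (measurableSet_agreeSet ω), ← integral_neg, ← h1]
      refine integral_congr_ae (Eventually.of_forall fun σ => ?_)
      by_cases hσ : σ ∈ agreeSet ω
      · simp [Set.indicator, spinMul_mem_agreeSet_iff hτ, hσ, hχ.map_mul, hτ2]
      · simp [Set.indicator, spinMul_mem_agreeSet_iff hτ, hσ]
    simp only [triv, h, if_false, zero_mul]
    linarith

/-- The indicator of agreement along `e` is `(1 + bondSpin σ e) / 2`. A bond whose ends are already
forced to agree leaves the mass unchanged; any other bond merges two clusters and halves it. -/
lemma mass_insert (e : Sym2 Z2) (ω : Finset (Sym2 Z2)) :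
    mass (insert e ω) = mass ω * ((1 + triv (fun σ => bondSpin σ e) ω) / 2) := by
  have h1 : mass (insert e ω) = ∫ σ in agreeSet ω, (1 + bondSpin σ e) / 2 ∂fairSpins := by
    rw [mass, ← integral_indicator_one (measurableSet_agreeSet _),
      ← integral_indicator (measurableSet_agreeSet ω)]
    refine integral_congr_ae (Eventually.of_forall fun σ => ?_)
    rcases (isSpinChar_bondSpin e).eq_or σ with h | h <;>
      by_cases hσ : σ ∈ agreeSet ω <;>
      simp_all [Set.indicator, mem_agreeSet]
    norm_num
  have h2 : ∫ σ in agreeSet ω, (1 + bondSpin σ e) / 2 ∂fairSpins =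
      ((∫ σ in agreeSet ω, 1 ∂fairSpins) + ∫ σ in agreeSet ω, bondSpin σ e ∂fairSpins) / 2 := by
    rw [integral_div, integral_add (integrable_const _)
      ((isSpinChar_bondSpin e).integrable _)]
  rw [h1, h2, setIntegral_agreeSet (isSpinChar_bondSpin e)]
  simp [mass]
  ring

lemma mass_empty : mass ∅ = 1 := by
  simp [mass, agreeSet]

lemma mass_pos (ω : Finset (Sym2 Z2)) : 0 < mass ω := by
  induction ω using Finset.induction_on with
  | empty => simp [mass_empty]
  | insert e s _ ih =>
    rw [mass_insert]
    have := triv_nonneg (fun σ => bondSpin σ e) s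
    positivity

/-- The ratio `mass (s ∪ ω) / mass ω` increases with `ω`: each bond of `s` contributes a factor from
`mass_insert`, and that factor is increasing by `triv_mono`. -/
lemma mass_union_mul_le {ω η : Finset (Sym2 Z2)} (h : ω ⊆ η) (s : Finset (Sym2 Z2)) :
    mass (s ∪ ω) * mass η ≤ mass (s ∪ η) * mass ω := by
  induction s using Finset.induction_on with
  | empty => simp [mul_comm]
  | insert e s _ ih =>
    rw [Finset.insert_union, Finset.insert_union, mass_insert, mass_insert]
    have h1 := triv_mono (fun σ => bondSpin σ e) (Finset.union_subset_union_right (s := s) h)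
    have h2 := triv_nonneg (fun σ => bondSpin σ e) (s ∪ ω)
    have h3 := mass_nonneg (s ∪ η)
    have h4 := mass_nonneg ω
    calc _ = mass (s ∪ ω) * mass η * ((1 + triv (fun σ => bondSpin σ e) (s ∪ ω)) / 2) := by ring
      _ ≤ mass (s ∪ η) * mass ω * ((1 + triv (fun σ => bondSpin σ e) (s ∪ η)) / 2) := by
        gcongr
      _ = _ := by ring

/-- The mass is log-supermodular. -/
lemma mass_mul_mass_le (ω η : Finset (Sym2 Z2)) :
    mass ω * mass η ≤ mass (ω ∩ η) * mass (ω ∪ η) := by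
  have h := mass_union_mul_le (Finset.inter_subset_right (s₁ := ω) (s₂ := η)) ω
  rw [Finset.union_eq_left.2 Finset.inter_subset_left] at h
  linarith

/-! Random-cluster weights and the FKG inequality. -/

/-- The FKG inequality for a log-supermodular weight on the subsets of a finite set. -/
lemma fkg_powerset {α : Type*} [DecidableEq α] (E : Finset α) {μ f g : Finset α → ℝ}
    (hμ₀ : 0 ≤ μ) (hf₀ : 0 ≤ f) (hg₀ : 0 ≤ g) (hf : Monotone f) (hg : Monotone g)
    (hμ : ∀ ω ⊆ E, ∀ η ⊆ E, μ ω * μ η ≤ μ (ω ∩ η) * μ (ω ∪ η)) :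
    (∑ ω ∈ E.powerset, μ ω * f ω) * ∑ ω ∈ E.powerset, μ ω * g ω ≤
      (∑ ω ∈ E.powerset, μ ω) * ∑ ω ∈ E.powerset, μ ω * (f ω * g ω) := by
  -- The general FKG inequality concerns a finite distributive lattice, so the subsets of `E` are
  -- made into one.
  let L : Sublattice (Finset α) :=
    { carrier := E.powerset
      supClosed' := fun ω hω η hη => by
        simp only [Finset.mem_coe, Finset.mem_powerset] at hω hη ⊢
        exact Finset.union_subset hω hη
      infClosed' := fun ω hω η hη => by
        simp only [Finset.mem_coe, Finset.mem_powerset] at hω hη ⊢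
        exact Finset.inter_subset_left.trans hω }
  let : Fintype L := inferInstanceAs (Fintype (E.powerset : Set (Finset α)))
  have hsum (F : Finset α → ℝ) : ∑ ω ∈ E.powerset, F ω = ∑ ω : L, F ω := by
    rw [← Finset.sum_coe_sort]
    exact Fintype.sum_equiv (Equiv.refl _) _ _ fun _ => rfl
  have hL (ω : L) : (ω : Finset α) ⊆ E := Finset.mem_powerset.1 ω.2
  simp only [hsum]
  exact fkg (α := L) (μ := fun ω => μ ω) (f := fun ω => f ω) (g := fun ω => g ω)
    (fun ω => hμ₀ _) (fun ω => hf₀ _) (fun ω => hg₀ _) (fun _ _ h => hf h) (fun _ _ h => hg h)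
    fun ω η => hμ _ (hL ω) _ (hL η)

/-- The independent percolation weight of `ω` as a configuration of open bonds among `E`. -/
def percWeight (p : ℝ) (E ω : Finset (Sym2 Z2)) : ℝ := p ^ ω.card * (1 - p) ^ (E \ ω).card

/-- The random-cluster weight with cluster weight `2`, in terms of `mass`. The bonds in `W` are
present throughout. -/
def rcWeight (p : ℝ) (W E ω : Finset (Sym2 Z2)) : ℝ := percWeight p E ω * mass (ω ∪ W)

/-- The unnormalized expectation of `f` for the random-cluster weight. -/
def rcSum (p : ℝ) (W E : Finset (Sym2 Z2)) (f : Finset (Sym2 Z2) → ℝ) : ℝ :=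
  ∑ ω ∈ E.powerset, rcWeight p W E ω * f ω

lemma percWeight_nonneg {p : ℝ} (h0 : 0 ≤ p) (h1 : p < 1) (E ω : Finset (Sym2 Z2)) :
    0 ≤ percWeight p E ω :=
  mul_nonneg (pow_nonneg h0 _) (pow_nonneg (by linarith) _)

/-- The independent weight is log-modular, so the log-supermodularity of `rcWeight` rests on `mass`
alone. -/
lemma percWeight_inter_mul_union (p : ℝ) (E ω η : Finset (Sym2 Z2)) :
    percWeight p E (ω ∩ η) * percWeight p E (ω ∪ η) = percWeight p E ω * percWeight p E η := by
  have h1 := Finset.card_union_add_card_inter ω η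
  have h2 := Finset.card_union_add_card_inter (E \ ω) (E \ η)
  rw [← Finset.sdiff_inter_distrib_right, ← Finset.sdiff_union_distrib] at h2
  simp only [percWeight]
  calc _ = p ^ ((ω ∪ η).card + (ω ∩ η).card) *
        (1 - p) ^ ((E \ (ω ∩ η)).card + (E \ (ω ∪ η)).card) := by ring
    _ = _ := by rw [h1, h2]; ring

lemma percWeight_union (p : ℝ) {E F ω η : Finset (Sym2 Z2)} (hEF : Disjoint E F) (hω : ω ⊆ E)
    (hη : η ⊆ F) : percWeight p (E ∪ F) (ω ∪ η) = percWeight p E ω * percWeight p F η := by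
  have h1 : (ω ∪ η).card = ω.card + η.card :=
    Finset.card_union_of_disjoint (hEF.mono hω hη)
  have h2 : ((E ∪ F) \ (ω ∪ η)) = (E \ ω) ∪ (F \ η) := by
    ext e
    have := fun he : e ∈ E => Finset.disjoint_left.1 hEF he
    have := @hω e
    have := @hη e
    simp only [Finset.mem_sdiff, Finset.mem_union]
    tauto
  have h3 : ((E \ ω) ∪ (F \ η)).card = (E \ ω).card + (F \ η).card :=
    Finset.card_union_of_disjoint (hEF.mono Finset.sdiff_subset Finset.sdiff_subset)
  simp only [percWeight, h1, h2, h3]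
  ring

lemma rcWeight_nonneg {p : ℝ} (h0 : 0 ≤ p) (h1 : p < 1) (W E ω : Finset (Sym2 Z2)) :
    0 ≤ rcWeight p W E ω :=
  mul_nonneg (percWeight_nonneg h0 h1 E ω) (mass_nonneg _)

lemma rcSum_mono {p : ℝ} (h0 : 0 ≤ p) (h1 : p < 1) {W E : Finset (Sym2 Z2)}
    {f g : Finset (Sym2 Z2) → ℝ} (h : ∀ ω ⊆ E, f ω ≤ g ω) : rcSum p W E f ≤ rcSum p W E g :=
  Finset.sum_le_sum fun ω hω =>
    mul_le_mul_of_nonneg_left (h ω (Finset.mem_powerset.1 hω)) (rcWeight_nonneg h0 h1 _ _ _)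

lemma rcSum_one_pos {p : ℝ} (h0 : 0 ≤ p) (h1 : p < 1) (W E : Finset (Sym2 Z2)) :
    0 < rcSum p W E 1 := by
  refine Finset.sum_pos' (fun ω _ => ?_) ⟨∅, Finset.empty_mem_powerset E, ?_⟩
  · simpa using rcWeight_nonneg h0 h1 W E ω
  · have := mass_pos W
    have : 0 < 1 - p := by linarith
    simp only [rcWeight, percWeight, Pi.one_apply, Finset.card_empty, Finset.sdiff_empty,
      Finset.empty_union]
    positivity

/-- The FKG inequality for the weight `mass (ω ∪ W)` on the subsets `ω` of `E`. -/
lemma rcSum_fkg {p : ℝ} (h0 : 0 ≤ p) (h1 : p < 1) (W E : Finset (Sym2 Z2))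
    {f g : Finset (Sym2 Z2) → ℝ} (hf₀ : 0 ≤ f) (hg₀ : 0 ≤ g) (hf : Monotone f)
    (hg : Monotone g) :
    rcSum p W E f * rcSum p W E g ≤ rcSum p W E 1 * rcSum p W E (f * g) := by
  have := fkg_powerset E (μ := rcWeight p W E) (rcWeight_nonneg h0 h1 W E) hf₀ hg₀ hf hg
    fun ω _ η _ => by
      have h := mass_mul_mass_le (ω ∪ W) (η ∪ W)
      rw [← Finset.inter_union_distrib_right, ← Finset.union_union_distrib_right] at h
      calc rcWeight p W E ω * rcWeight p W E η
          = percWeight p E ω * percWeight p E η * (mass (ω ∪ W) * mass (η ∪ W)) := by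
            simp only [rcWeight]; ring
        _ ≤ percWeight p E ω * percWeight p E η * (mass (ω ∩ η ∪ W) * mass (ω ∪ η ∪ W)) :=
            mul_le_mul_of_nonneg_left h
              (mul_nonneg (percWeight_nonneg h0 h1 _ _) (percWeight_nonneg h0 h1 _ _))
        _ = _ := by
            rw [← percWeight_inter_mul_union]
            simp only [rcWeight]; ring
  simpa [rcSum] using this

lemma sum_powerset_union {α M : Type*} [DecidableEq α] [AddCommMonoid M] {E F : Finset α}
    (hEF : Disjoint E F) (φ : Finset α → M) :
    ∑ ω ∈ (E ∪ F).powerset, φ ω = ∑ η ∈ F.powerset, ∑ ω ∈ E.powerset, φ (ω ∪ η) := by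
  rw [← Finset.sum_product']
  refine Finset.sum_nbij' (fun ω => (ω ∩ F, ω ∩ E)) (fun x => x.2 ∪ x.1) ?_ ?_ ?_ ?_ ?_
  · simp
  · intro x hx
    simp only [Finset.mem_product, Finset.mem_powerset] at hx ⊢
    exact Finset.union_subset_union hx.2 hx.1
  · intro ω hω
    simp only [Finset.mem_powerset] at hω
    rw [← Finset.inter_union_distrib_left, Finset.inter_eq_left.2 hω]
  · intro x hx
    simp only [Finset.mem_product, Finset.mem_powerset] at hx
    have h3 := Finset.disjoint_left.1 hEF
    ext e <;> have := @hx.1 e <;> have := @hx.2 e <;> have := @h3 e <;>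
      simp only [Finset.mem_inter, Finset.mem_union] <;> tauto
  · intro ω hω
    simp only [Finset.mem_powerset] at hω
    rw [← Finset.inter_union_distrib_left, Finset.inter_eq_left.2 hω]

/-- An increasing event in `E` is at most as likely, given the bonds in `F`, as under the wired
weight. The hypothesis `hfac` says that the bonds of `F` do not influence those of `E` in the
presence of the wiring `W`. -/
lemma rcSum_mul_le_wired {p : ℝ} (h0 : 0 ≤ p) (h1 : p < 1) {W E F : Finset (Sym2 Z2)}
    (hEF : Disjoint E F)
    (hfac : ∀ η ⊆ F, ∀ ω ⊆ E, mass (W ∪ (ω ∪ η)) * mass W = mass (ω ∪ W) * mass (W ∪ η))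
    {f g : Finset (Sym2 Z2) → ℝ} (hf₀ : 0 ≤ f) (hg₀ : 0 ≤ g) (hf : Monotone f)
    (hfE : ∀ η ⊆ F, ∀ ω ⊆ E, f (ω ∪ η) = f ω) (hgF : ∀ η ⊆ F, ∀ ω ⊆ E, g (ω ∪ η) = g η) :
    rcSum p ∅ (E ∪ F) (f * g) * rcSum p W E 1 ≤
      rcSum p W E f * rcSum p ∅ (E ∪ F) g := by
  -- For a fixed configuration `η` on `F`, the wired weight on `E` has density proportional to `h`
  -- with respect to the weight conditioned on `η`. As `h` is increasing, FKG favours `f` under the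
  -- wired weight.
  have inner : ∀ η ⊆ F, rcSum p η E f * rcSum p W E 1 ≤ rcSum p W E f * rcSum p η E 1 := by
    intro η hη
    set h : Finset (Sym2 Z2) → ℝ := fun ω => mass (W ∪ (ω ∪ η)) / mass (ω ∪ η) with hh
    have hmono : Monotone h := fun ω ω' hω => by
      have := mass_union_mul_le (Finset.union_subset_union_left (t := η) hω) W
      exact (div_le_div_iff₀ (mass_pos _) (mass_pos _)).2 this
    have key := rcSum_fkg h0 h1 η E hf₀ (g := h)
      (fun ω => div_nonneg (mass_nonneg _) (mass_nonneg _)) hf hmono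
    have hc : 0 < mass (W ∪ η) / mass W := div_pos (mass_pos _) (mass_pos _)
    -- By `hfac`, reweighting by `h` gives the wired sum up to a constant independent of `ω`.
    have hW : ∀ φ, rcSum p η E (φ * h) = rcSum p W E φ * (mass (W ∪ η) / mass W) := by
      intro φ
      rw [rcSum, rcSum, Finset.sum_mul]
      refine Finset.sum_congr rfl fun ω hω => ?_
      have h2 := hfac η hη ω (Finset.mem_powerset.1 hω)
      have h3 := (mass_pos (ω ∪ η)).ne'
      have h4 := (mass_pos W).ne'
      simp only [Pi.mul_apply, hh, rcWeight]
      field_simp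
      rw [mul_assoc _ (mass (W ∪ (ω ∪ η))), h2]
      ring
    have hW1 := hW 1
    rw [one_mul] at hW1
    rw [hW1, hW] at key
    refine le_of_mul_le_mul_right ?_ hc
    linarith
  -- Conditioning on the bonds of `F`: seen from `E`, the open bonds `η` act as a wiring.
  have hsplit : ∀ φ : Finset (Sym2 Z2) → ℝ, rcSum p ∅ (E ∪ F) φ =
      ∑ η ∈ F.powerset, ∑ ω ∈ E.powerset, percWeight p F η * (rcWeight p η E ω * φ (ω ∪ η)) := by
    intro φ
    rw [rcSum, sum_powerset_union hEF]
    refine Finset.sum_congr rfl fun η hη => Finset.sum_congr rfl fun ω hω => ?_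
    rw [rcWeight, percWeight_union p hEF (Finset.mem_powerset.1 hω) (Finset.mem_powerset.1 hη),
      Finset.union_empty, rcWeight]
    ring
  have h2 : rcSum p ∅ (E ∪ F) (f * g) =
      ∑ η ∈ F.powerset, percWeight p F η * g η * rcSum p η E f := by
    rw [hsplit]
    refine Finset.sum_congr rfl fun η hη => ?_
    rw [rcSum, Finset.mul_sum]
    refine Finset.sum_congr rfl fun ω hω => ?_
    rw [Pi.mul_apply, hfE η (Finset.mem_powerset.1 hη) ω (Finset.mem_powerset.1 hω),
      hgF η (Finset.mem_powerset.1 hη) ω (Finset.mem_powerset.1 hω)]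
    ring
  have h3 : rcSum p ∅ (E ∪ F) g =
      ∑ η ∈ F.powerset, percWeight p F η * g η * rcSum p η E 1 := by
    rw [hsplit]
    refine Finset.sum_congr rfl fun η hη => ?_
    rw [rcSum, Finset.mul_sum]
    refine Finset.sum_congr rfl fun ω hω => ?_
    rw [hgF η (Finset.mem_powerset.1 hη) ω (Finset.mem_powerset.1 hω), Pi.one_apply]
    ring
  rw [h2, h3, Finset.sum_mul, Finset.mul_sum]
  refine Finset.sum_le_sum fun η hη => ?_
  have := mul_le_mul_of_nonneg_left (inner η (Finset.mem_powerset.1 hη))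
    (mul_nonneg (percWeight_nonneg h0 h1 F η) (hg₀ η))
  linarith

/-! The Edwards-Sokal expansion. -/

/-- The bonds of `E` along which `σ` agrees. -/
def agreeIn (E : Finset (Sym2 Z2)) (σ : Spins) : Finset (Sym2 Z2) := by
  classical exact E.filter fun e => bondSpin σ e = 1

lemma mem_agreeIn {E : Finset (Sym2 Z2)} {σ : Spins} {e : Sym2 Z2} :
    e ∈ agreeIn E σ ↔ e ∈ E ∧ bondSpin σ e = 1 := by
  classical simp [agreeIn]

lemma agreeIn_subset (E : Finset (Sym2 Z2)) (σ : Spins) : agreeIn E σ ⊆ E :=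
  fun _ he => (mem_agreeIn.1 he).1

lemma subset_agreeIn_iff {E ω : Finset (Sym2 Z2)} {σ : Spins} (hω : ω ⊆ E) :
    ω ⊆ agreeIn E σ ↔ σ ∈ agreeSet ω :=
  ⟨fun h _ he => (mem_agreeIn.1 (h he)).2, fun h e he => mem_agreeIn.2 ⟨hω he, h e he⟩⟩

/-- The Boltzmann factor of the bonds in `E`. -/
def boltzmann (β : ℝ) (E : Finset (Sym2 Z2)) (σ : Spins) : ℝ :=
  Real.exp (β * ∑ e ∈ E, bondSpin σ e)

lemma boltzmann_eq (β : ℝ) (E : Finset (Sym2 Z2)) (σ : Spins) :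
    boltzmann β E σ =
      Real.exp β ^ E.card * Real.exp (-2 * β) ^ (E \ agreeIn E σ).card := by
  have h1 : ∀ e ∈ agreeIn E σ, bondSpin σ e = 1 := fun _ he => (mem_agreeIn.1 he).2
  have h2 : ∀ e ∈ E \ agreeIn E σ, bondSpin σ e = -1 := fun e he => by
    rw [Finset.mem_sdiff, mem_agreeIn] at he
    exact ((isSpinChar_bondSpin e).eq_or σ).resolve_left fun h => he.2 ⟨he.1, h⟩
  have h3 := Finset.card_sdiff_add_card_eq_card (agreeIn_subset E σ)
  rw [boltzmann, ← Finset.sum_sdiff (agreeIn_subset E σ), Finset.sum_congr rfl h1,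
    Finset.sum_congr rfl h2, ← h3, ← Real.exp_nat_mul, ← Real.exp_nat_mul, ← Real.exp_add]
  congr 1
  simp
  ring

/-- The Boltzmann factor times an expectation under independent percolation on the agreeing bonds
is an expansion over bond configurations. -/
lemma boltzmann_mul_sum {β p : ℝ} (hp : p = 1 - Real.exp (-2 * β)) (E : Finset (Sym2 Z2))
    (σ : Spins) (f : Finset (Sym2 Z2) → ℝ) :
    boltzmann β E σ * ∑ ω ∈ (agreeIn E σ).powerset, percWeight p (agreeIn E σ) ω * f ω =
      Real.exp β ^ E.card *
        ∑ ω ∈ E.powerset, (agreeSet ω).indicator (fun _ => percWeight p E ω * f ω) σ := by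
  -- The cost `exp (-2 * β)` of a disagreeing bond equals the weight `1 - p` of a closed bond; hence
  -- every disagreeing bond can be counted as closed.
  have hq : Real.exp (-2 * β) = 1 - p := by rw [hp]; ring
  rw [boltzmann_eq, hq, mul_assoc, Finset.mul_sum]
  congr 1
  rw [← Finset.sum_subset (Finset.powerset_mono.2 (agreeIn_subset E σ))]
  · refine Finset.sum_congr rfl fun ω hω => ?_
    rw [Finset.mem_powerset] at hω
    rw [Set.indicator_of_mem ((subset_agreeIn_iff (hω.trans (agreeIn_subset E σ))).1 hω)]
    have h3 : (E \ ω).card = (E \ agreeIn E σ).card + (agreeIn E σ \ ω).card := by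
      rw [← Finset.card_union_of_disjoint
        (Finset.sdiff_disjoint.mono_right Finset.sdiff_subset)]
      congr 1
      ext e
      have := @hω e
      have := @agreeIn_subset E σ e
      simp only [Finset.mem_sdiff, Finset.mem_union]
      tauto
    simp only [percWeight, h3]
    ring
  · intro ω hω hω'
    rw [Finset.mem_powerset] at hω hω'
    exact Set.indicator_of_notMem (fun h => hω' ((subset_agreeIn_iff hω).2 h)) _

lemma sum_percWeight (p : ℝ) (E : Finset (Sym2 Z2)) :
    ∑ ω ∈ E.powerset, percWeight p E ω = 1 := by
  have h := Finset.sum_pow_mul_eq_add_pow p (1 - p) E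
  rw [add_sub_cancel, one_pow] at h
  rw [← h]
  refine Finset.sum_congr rfl fun ω hω => ?_
  rw [percWeight, Finset.card_sdiff_of_subset (Finset.mem_powerset.1 hω)]

lemma boltzmann_eq_sum {β p : ℝ} (hp : p = 1 - Real.exp (-2 * β)) (E : Finset (Sym2 Z2))
    (σ : Spins) :
    boltzmann β E σ = Real.exp β ^ E.card *
      ∑ ω ∈ E.powerset, (agreeSet ω).indicator (fun _ => percWeight p E ω) σ := by
  have h := boltzmann_mul_sum hp E σ 1
  simpa [sum_percWeight] using h

/-- The spins are summed out first, at fixed `ω`; by orthogonality only those `ω` that force `χ = 1`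
contribute. -/
lemma integral_boltzmann_mul_char {β p : ℝ} (hp : p = 1 - Real.exp (-2 * β))
    (E : Finset (Sym2 Z2)) {χ : Spins → ℝ} (hχ : IsSpinChar χ) :
    ∫ σ, boltzmann β E σ * χ σ ∂fairSpins = Real.exp β ^ E.card * rcSum p ∅ E (triv χ) := by
  have h1 : ∀ σ, boltzmann β E σ * χ σ = Real.exp β ^ E.card *
      ∑ ω ∈ E.powerset, percWeight p E ω * (agreeSet ω).indicator χ σ := by
    intro σ
    rw [boltzmann_eq_sum hp, mul_assoc, Finset.sum_mul]
    congr 1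
    refine Finset.sum_congr rfl fun ω _ => ?_
    by_cases hσ : σ ∈ agreeSet ω <;> simp [hσ]
  simp_rw [h1]
  rw [integral_const_mul, integral_finsetSum]
  · congr 1
    refine Finset.sum_congr rfl fun ω _ => ?_
    rw [integral_const_mul, integral_indicator (measurableSet_agreeSet ω),
      setIntegral_agreeSet hχ, rcWeight, Finset.union_empty]
    ring
  · exact fun ω _ => ((hχ.integrable _).indicator (measurableSet_agreeSet ω)).const_mul _

/-- The bond marginal of the Edwards-Sokal coupling: percolation on the agreeing bonds of Ising
spins has the random-cluster law. -/
lemma integral_boltzmann_mul_perc {β p : ℝ} (hp : p = 1 - Real.exp (-2 * β))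
    (E : Finset (Sym2 Z2)) (f : Finset (Sym2 Z2) → ℝ) :
    ∫ σ, boltzmann β E σ *
        ∑ ω ∈ (agreeIn E σ).powerset, percWeight p (agreeIn E σ) ω * f ω ∂fairSpins =
      Real.exp β ^ E.card * rcSum p ∅ E f := by
  simp_rw [boltzmann_mul_sum hp]
  rw [integral_const_mul, integral_finsetSum]
  · congr 1
    refine Finset.sum_congr rfl fun ω _ => ?_
    rw [integral_indicator (measurableSet_agreeSet ω), setIntegral_const, rcWeight,
      Finset.union_empty, smul_eq_mul, mass]
    ring
  · exact fun ω _ => (integrable_const _).indicator (measurableSet_agreeSet ω)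

lemma integral_boltzmann {β p : ℝ} (hp : p = 1 - Real.exp (-2 * β)) (E : Finset (Sym2 Z2)) :
    ∫ σ, boltzmann β E σ ∂fairSpins = Real.exp β ^ E.card * rcSum p ∅ E 1 := by
  have h := integral_boltzmann_mul_perc hp E 1
  simpa [sum_percWeight] using h

lemma integral_isingFree (β : ℝ) (Λ : Finset Z2) (φ : Spins → ℝ) :
    ∫ σ, φ σ ∂(isingFree β Λ : Measure Spins) =
      (∫ σ, boltzmann β (bondsIn Λ) σ * φ σ ∂fairSpins) /
        ∫ σ, boltzmann β (bondsIn Λ) σ ∂fairSpins := by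
  have h : ∫ σ, φ σ ∂(isingFree β Λ : Measure Spins) =
      ∫ σ, φ σ ∂(fairSpins.tilted fun σ => β * ∑ e ∈ bondsIn Λ, bondSpin σ e) := rfl
  rw [h, integral_tilted, ← integral_div]
  refine integral_congr_ae (Eventually.of_forall fun σ => ?_)
  simp only [boltzmann, smul_eq_mul]
  ring

lemma integral_isingFree_char {β p : ℝ} (hp : p = 1 - Real.exp (-2 * β)) (Λ : Finset Z2)
    {χ : Spins → ℝ} (hχ : IsSpinChar χ) :
    ∫ σ, χ σ ∂(isingFree β Λ : Measure Spins) =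
      rcSum p ∅ (bondsIn Λ) (triv χ) / rcSum p ∅ (bondsIn Λ) 1 := by
  rw [integral_isingFree, integral_boltzmann_mul_char hp _ hχ, integral_boltzmann hp,
    mul_div_mul_left _ _ (pow_ne_zero _ (Real.exp_ne_zero _))]

lemma integral_isingFree_perc {β p : ℝ} (hp : p = 1 - Real.exp (-2 * β)) (Λ : Finset Z2)
    (f : Finset (Sym2 Z2) → ℝ) :
    ∫ σ, ∑ ω ∈ (agreeIn (bondsIn Λ) σ).powerset, percWeight p (agreeIn (bondsIn Λ) σ) ω * f ω
        ∂(isingFree β Λ : Measure Spins) =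
      rcSum p ∅ (bondsIn Λ) f / rcSum p ∅ (bondsIn Λ) 1 := by
  rw [integral_isingFree, integral_boltzmann_mul_perc hp, integral_boltzmann hp,
    mul_div_mul_left _ _ (pow_ne_zero _ (Real.exp_ne_zero _))]

/-! Griffiths' inequality and the infinite-volume limit. -/

/-- The expectation of `φ` in the Ising model with interaction along the bonds of `E`. -/
def isingMean (β : ℝ) (E : Finset (Sym2 Z2)) (φ : Spins → ℝ) : ℝ :=
  (∫ σ, boltzmann β E σ * φ σ ∂fairSpins) / ∫ σ, boltzmann β E σ ∂fairSpins

lemma measurable_boltzmann (β : ℝ) (E : Finset (Sym2 Z2)) : Measurable (boltzmann β E) :=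
  ((Finset.measurable_sum _ fun e _ => measurable_bondSpin e).const_mul β).exp

lemma integrable_boltzmann_mul (β : ℝ) (E : Finset (Sym2 Z2)) {χ : Spins → ℝ}
    (hχ : IsSpinChar χ) : Integrable (fun σ => boltzmann β E σ * χ σ) fairSpins := by
  refine Integrable.of_bound ((measurable_boltzmann β E).mul hχ.measurable).aestronglyMeasurable
    (Real.exp (|β| * E.card)) (Eventually.of_forall fun σ => ?_)
  rw [norm_mul, Real.norm_eq_abs, Real.norm_eq_abs, hχ.abs_eq, mul_one, boltzmann, Real.abs_exp,
    Real.exp_le_exp]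
  refine (le_abs_self _).trans ?_
  rw [abs_mul]
  refine mul_le_mul_of_nonneg_left ((Finset.abs_sum_le_sum_abs _ _).trans ?_) (abs_nonneg β)
  simpa using Finset.sum_le_sum fun e (_ : e ∈ E) => abs_bondSpin_le σ e

/-- For `s = ±1` one has `exp (β * s) = cosh β + s * sinh β`. -/
lemma boltzmann_insert (β : ℝ) {e : Sym2 Z2} {E : Finset (Sym2 Z2)} (he : e ∉ E) (σ : Spins) :
    boltzmann β (insert e E) σ =
      Real.cosh β * boltzmann β E σ + Real.sinh β * (boltzmann β E σ * bondSpin σ e) := by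
  rw [boltzmann, Finset.sum_insert he, mul_add, Real.exp_add, boltzmann]
  rcases (isSpinChar_bondSpin e).eq_or σ with h | h <;> rw [h]
  · rw [mul_one, ← Real.cosh_add_sinh]; ring
  · rw [mul_neg, mul_one, Real.exp_neg, ← Real.exp_neg, ← Real.cosh_sub_sinh]; ring

/-- Expanding the new bond reduces the claim to Griffiths' second inequality `⟨χ⟩⟨b⟩ ≤ ⟨χ b⟩`, where
`b` is the bond spin. In random-cluster form this is FKG for the two increasing functions `triv`,
followed by `triv_mul_le`. -/
lemma isingMean_le_insert {β : ℝ} (hβ : 0 ≤ β) {e : Sym2 Z2} {E : Finset (Sym2 Z2)}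
    (he : e ∉ E) {χ : Spins → ℝ} (hχ : IsSpinChar χ) :
    isingMean β E χ ≤ isingMean β (insert e E) χ := by
  obtain ⟨p, hp⟩ : ∃ p, p = 1 - Real.exp (-2 * β) := ⟨_, rfl⟩
  have hp0 : 0 ≤ p := by
    have : Real.exp (-2 * β) ≤ 1 := Real.exp_le_one_iff.2 (by linarith)
    linarith
  have hp1 : p < 1 := by have := Real.exp_pos (-2 * β); linarith
  have hb := isSpinChar_bondSpin e
  have h1 : ∫ σ, boltzmann β (insert e E) σ * χ σ ∂fairSpins =
      Real.cosh β * ∫ σ, boltzmann β E σ * χ σ ∂fairSpins +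
        Real.sinh β * ∫ σ, boltzmann β E σ * (χ σ * bondSpin σ e) ∂fairSpins := by
    rw [← integral_const_mul, ← integral_const_mul, ← integral_add
      ((integrable_boltzmann_mul β E hχ).const_mul _)
      ((integrable_boltzmann_mul β E (hχ.mul hb)).const_mul _)]
    refine integral_congr_ae (Eventually.of_forall fun σ => ?_)
    simp only [boltzmann_insert β he]
    ring
  have h2 : ∫ σ, boltzmann β (insert e E) σ ∂fairSpins =
      Real.cosh β * ∫ σ, boltzmann β E σ ∂fairSpins +
        Real.sinh β * ∫ σ, boltzmann β E σ * bondSpin σ e ∂fairSpins := by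
    have h3 : Integrable (boltzmann β E) fairSpins := by
      simpa using integrable_boltzmann_mul β E isSpinChar_one
    rw [← integral_const_mul, ← integral_const_mul, ← integral_add
      (h3.const_mul _) ((integrable_boltzmann_mul β E hb).const_mul _)]
    exact integral_congr_ae (Eventually.of_forall fun σ => boltzmann_insert β he σ)
  have hexp : 0 < Real.exp β ^ E.card := pow_pos (Real.exp_pos _) _
  have hR1 := rcSum_one_pos hp0 hp1 ∅ E
  have hRe : 0 ≤ rcSum p ∅ E (triv fun σ => bondSpin σ e) :=
    Finset.sum_nonneg fun ω _ => mul_nonneg (rcWeight_nonneg hp0 hp1 _ _ _) (triv_nonneg _ _)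
  have hs : 0 ≤ Real.sinh β := Real.sinh_nonneg_iff.2 hβ
  have hc : 0 < Real.cosh β := Real.cosh_pos β
  have hfkg := rcSum_fkg hp0 hp1 ∅ E (f := triv χ) (g := triv fun σ => bondSpin σ e)
    (triv_nonneg _) (triv_nonneg _) (triv_mono _) (triv_mono _)
  have hle : rcSum p ∅ E (triv χ * triv fun σ => bondSpin σ e) ≤
      rcSum p ∅ E (triv fun σ => χ σ * bondSpin σ e) :=
    rcSum_mono hp0 hp1 fun ω _ => triv_mul_le _ _ ω
  have hgks := hfkg.trans (mul_le_mul_of_nonneg_left hle hR1.le)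
  rw [isingMean, isingMean, h1, h2, integral_boltzmann_mul_char hp _ hχ,
    integral_boltzmann_mul_char hp _ (hχ.mul hb), integral_boltzmann_mul_char hp _ hb,
    integral_boltzmann hp, div_le_div_iff₀ (by positivity) (by positivity)]
  -- After cross-multiplication the `cosh` terms cancel, leaving `hgks` times this factor.
  have := mul_le_mul_of_nonneg_left hgks
    (show 0 ≤ Real.sinh β * (Real.exp β ^ E.card * Real.exp β ^ E.card) by positivity)
  linarith

lemma isingMean_mono {β : ℝ} (hβ : 0 ≤ β) {E E' : Finset (Sym2 Z2)} (h : E ⊆ E')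
    {χ : Spins → ℝ} (hχ : IsSpinChar χ) : isingMean β E χ ≤ isingMean β E' χ := by
  have key : ∀ s : Finset (Sym2 Z2), isingMean β E χ ≤ isingMean β (s ∪ E) χ := by
    intro s
    induction s using Finset.induction_on with
    | empty => simp
    | insert e s _ ih =>
      rw [Finset.insert_union]
      by_cases he : e ∈ s ∪ E
      · rwa [Finset.insert_eq_of_mem he]
      · exact ih.trans (isingMean_le_insert hβ he hχ)
  simpa [Finset.union_eq_left.2 h] using key E'

lemma bondsIn_mono {Λ Λ' : Finset Z2} (h : Λ ⊆ Λ') : bondsIn Λ ⊆ bondsIn Λ' := by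
  classical
  exact Finset.filter_subset_filter _ (Finset.sym2_mono h)

lemma integral_isingFree_mono {β : ℝ} (hβ : 0 ≤ β) {χ : Spins → ℝ} (hχ : IsSpinChar χ) :
    Monotone fun Λ : Finset Z2 => ∫ σ, χ σ ∂(isingFree β Λ : Measure Spins) := by
  intro Λ Λ' h
  simp only [integral_isingFree]
  exact isingMean_mono hβ (bondsIn_mono h) hχ

lemma abs_integral_char_le {χ : Spins → ℝ} (hχ : IsSpinChar χ) (μ : ProbabilityMeasure Spins) :
    |∫ σ, χ σ ∂(μ : Measure Spins)| ≤ 1 := by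
  have := norm_integral_le_of_norm_le_const (μ := (μ : Measure Spins)) (f := χ) (C := 1)
    (Eventually.of_forall fun σ => (hχ.abs_eq σ).le)
  simpa using this

lemma continuous_of_local {φ : Spins → ℝ} (Λ : Finset Z2)
    (h : ∀ σ τ : Spins, (∀ z ∈ Λ, σ z = τ z) → φ σ = φ τ) : Continuous φ := by
  let ext : (Λ → Bool) → Spins := fun s z => if hz : z ∈ Λ then s ⟨z, hz⟩ else true
  have h1 : φ = (φ ∘ ext) ∘ Λ.restrict := by
    funext σ
    exact h _ _ fun z hz => by simp [ext, hz]
  rw [h1]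
  exact (continuous_of_discreteTopology (f := φ ∘ ext)).comp
    (continuous_pi fun z => continuous_apply _)

lemma continuous_integral {φ : Spins → ℝ} (h : Continuous φ) :
    Continuous fun μ : ProbabilityMeasure Spins => ∫ σ, φ σ ∂(μ : Measure Spins) :=
  continuous_iff_continuousAt.2 fun _ =>
    ProbabilityMeasure.tendsto_iff_forall_integral_tendsto.1 tendsto_id
      (BoundedContinuousFunction.mkOfCompact ⟨φ, h⟩)

lemma continuous_prod_spin (A : Finset Z2) : Continuous fun σ : Spins => ∏ z ∈ A, spin σ z :=
  continuous_of_local A fun σ τ h => Finset.prod_congr rfl fun z hz => by simp [spin, h z hz]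

/-- A probability measure on the spin configurations is determined by its correlations. -/
lemma ext_of_correlations {μ ν : ProbabilityMeasure Spins}
    (h : ∀ A : Finset Z2, ∫ σ, ∏ z ∈ A, spin σ z ∂(μ : Measure Spins) =
      ∫ σ, ∏ z ∈ A, spin σ z ∂(ν : Measure Spins)) : μ = ν := by
  -- The indicator of a spin pattern `s` on `Λ` is the product over `z` in `Λ` of `(1 + s z * spin σ
  -- z) / 2`; expanding it writes the finite marginals in terms of correlations.
  have key : ∀ (Λ : Finset Z2) (s : Λ → Bool) (ρ : ProbabilityMeasure Spins),
      ((ρ : Measure Spins).map Λ.restrict).real {s} =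
        ∑ A ∈ Λ.powerset, (∏ z ∈ A.subtype (· ∈ Λ), if s z then (1 : ℝ) else -1) / 2 ^ Λ.card *
          ∫ σ, ∏ z ∈ A, spin σ z ∂(ρ : Measure Spins) := by
    intro Λ s ρ
    have hm : MeasurableSet (Λ.restrict ⁻¹' {s} : Set Spins) :=
      (Finset.measurable_restrict Λ) (measurableSet_singleton s)
    rw [measureReal_def, Measure.map_apply (Finset.measurable_restrict Λ)
      (measurableSet_singleton s), ← measureReal_def, ← integral_indicator_one hm]
    simp_rw [← integral_const_mul]
    rw [← integral_finsetSum]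
    swap
    · exact fun A _ => ((isSpinChar_prod A).integrable _).const_mul _
    refine integral_congr_ae (Eventually.of_forall fun σ => ?_)
    let t : Z2 → ℝ := fun z => if hz : z ∈ Λ then (if s ⟨z, hz⟩ then 1 else -1) else 1
    have h1 : ∀ A ∈ Λ.powerset, (∏ z ∈ A.subtype (· ∈ Λ), if s z then (1 : ℝ) else -1) =
        ∏ z ∈ A, t z := by
      intro A hA
      rw [Finset.mem_powerset] at hA
      rw [← Finset.prod_subtype_of_mem t (p := (· ∈ Λ)) fun z hz => hA hz]
      exact Finset.prod_congr rfl fun z _ => by simp [t]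
    have h2 : ∑ A ∈ Λ.powerset, (∏ z ∈ A.subtype (· ∈ Λ), if s z then (1 : ℝ) else -1) /
        2 ^ Λ.card * ∏ z ∈ A, spin σ z = ∏ z ∈ Λ, (1 + t z * spin σ z) / 2 := by
      rw [Finset.prod_div_distrib, Finset.prod_one_add, Finset.prod_const, Finset.sum_div]
      refine Finset.sum_congr rfl fun A hA => ?_
      rw [h1 A hA, Finset.prod_mul_distrib]
      ring
    simp only
    rw [h2]
    by_cases hσ : Λ.restrict σ = s
    · rw [Set.indicator_of_mem (by exact hσ)]
      refine (Finset.prod_eq_one fun z hz => ?_).symm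
      have : σ z = s ⟨z, hz⟩ := congrFun hσ ⟨z, hz⟩
      simp only [t, hz, spin, this, dite_true]
      cases s ⟨z, hz⟩ <;> norm_num
    · rw [Set.indicator_of_notMem (by exact hσ)]
      obtain ⟨z, hz⟩ := Function.ne_iff.1 hσ
      refine (Finset.prod_eq_zero z.2 ?_).symm
      have hz' : σ z ≠ s z := hz
      simp only [t, z.2, spin, dite_true, Subtype.coe_eta]
      revert hz'
      cases σ z <;> cases s z <;> norm_num
  apply Subtype.ext
  change (μ : Measure Spins) = (ν : Measure Spins)
  refine IsProjectiveLimit.unique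
    (P := fun I : Finset Z2 => (ν : Measure Spins).map I.restrict) (fun I => ?_) fun I => rfl
  have : IsProbabilityMeasure ((μ : Measure Spins).map I.restrict) :=
    Measure.isProbabilityMeasure_map (Finset.measurable_restrict I).aemeasurable
  have : IsProbabilityMeasure ((ν : Measure Spins).map I.restrict) :=
    Measure.isProbabilityMeasure_map (Finset.measurable_restrict I).aemeasurable
  refine Measure.ext_of_singleton fun s => ?_
  refine (measureReal_eq_measureReal_iff (measure_ne_top _ _) (measure_ne_top _ _)).1 ?_
  rw [key, key]
  simp only [h]

/-- The free-boundary Ising models converge in the infinite-volume limit. -/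
lemma exists_tendsto_isingFree {β : ℝ} (hβ : 0 ≤ β) :
    ∃ μ, Tendsto (isingFree β) atTop (𝓝 μ) := by
  -- Each correlation increases with the volume and is at most `1`.
  have hlim (A : Finset Z2) : ∃ c, Tendsto (fun Λ : Finset Z2 =>
      ∫ σ, ∏ z ∈ A, spin σ z ∂(isingFree β Λ : Measure Spins)) atTop (𝓝 c) :=
    ⟨_, tendsto_atTop_ciSup (integral_isingFree_mono hβ (isSpinChar_prod A)) ⟨1, by
      rintro _ ⟨Λ, rfl⟩
      exact (abs_le.1 (abs_integral_char_le (isSpinChar_prod A) _)).2⟩⟩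
  choose c hc using hlim
  -- Every cluster point has the limiting correlations, hence is unique; in a compact space this
  -- gives convergence.
  have hcluster : ∀ μ, ClusterPt μ (map (isingFree β) atTop) → ∀ A : Finset Z2,
      ∫ σ, ∏ z ∈ A, spin σ z ∂(μ : Measure Spins) = c A := by
    intro μ hμ A
    have h1 : ClusterPt (∫ σ, ∏ z ∈ A, spin σ z ∂(μ : Measure Spins)) (𝓝 (c A)) :=
      ClusterPt.map (f := fun ρ : ProbabilityMeasure Spins =>
          ∫ σ, ∏ z ∈ A, spin σ z ∂(ρ : Measure Spins)) hμ
        (continuous_integral (continuous_prod_spin A)).continuousAt (tendsto_map'_iff.2 (hc A))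
    have : NeBot (𝓝 (∫ σ, ∏ z ∈ A, spin σ z ∂(μ : Measure Spins)) ⊓ 𝓝 (c A)) := h1
    exact eq_of_nhds_neBot this
  obtain ⟨μ, hμ⟩ := exists_clusterPt_of_compactSpace (map (isingFree β) atTop)
  exact ⟨μ, le_nhds_of_unique_clusterPt fun ν hν =>
    ext_of_correlations fun A => (hcluster ν hν A).trans (hcluster μ hμ A).symm⟩

/-- The `limUnder` in the definition of `criticalIsing` is a genuine limit only because one exists.
-/
lemma tendsto_criticalIsing : Tendsto (isingFree betaC) atTop (𝓝 criticalIsing) :=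
  tendsto_nhds_limUnder (exists_tendsto_isingFree betaC_nonneg)

lemma tendsto_integral_criticalIsing {φ : Spins → ℝ} (h : Continuous φ) :
    Tendsto (fun Λ => ∫ σ, φ σ ∂(isingFree betaC Λ : Measure Spins)) atTop
      (𝓝 (∫ σ, φ σ ∂(criticalIsing : Measure Spins))) :=
  ((continuous_integral h).tendsto _).comp tendsto_criticalIsing

/-! Cylinder events of independent percolation. -/

lemma setBernoulli_cylinder {u : Bonds} (p : unitInterval) {E ω : Finset (Sym2 Z2)}
    (hE : (E : Bonds) ⊆ u) (hω : ω ⊆ E) :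
    (setBernoulli u p).real {η | ∀ e ∈ E, e ∈ η ↔ e ∈ ω} = percWeight p E ω := by
  classical
  have h1 : (fun p : Sym2 Z2 → Prop => {i | p i}) ⁻¹' {η : Bonds | ∀ e ∈ E, e ∈ η ↔ e ∈ ω} =
      (E : Set (Sym2 Z2)).pi fun e => {q | q ↔ e ∈ ω} := by
    ext q; simp [Set.pi]
  rw [measureReal_def, setBernoulli_apply', h1, Measure.infinitePi_pi]
  swap
  · exact fun _ _ => MeasurableSet.of_discrete
  rw [ENNReal.toReal_prod, ← Finset.prod_sdiff hω, percWeight, mul_comm]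
  have hE' : ∀ e ∈ E, e ∈ u := fun e he => hE he
  congr 1
  · refine Finset.prod_eq_pow_card fun e he => ?_
    simp [he, hE' e (hω he)]
  · refine Finset.prod_eq_pow_card fun e he => ?_
    rw [Finset.mem_sdiff] at he
    simp [he.2, hE' e he.1]

/-! Local events under the critical FK measure. -/

/-- The event `A` depends only on the bonds in `E`. -/
def IsLocalEvent (E : Finset (Sym2 Z2)) (A : Set Bonds) : Prop :=
  ∀ η η' : Bonds, (∀ e ∈ E, e ∈ η ↔ e ∈ η') → (η ∈ A ↔ η' ∈ A)

lemma IsLocalEvent.mono {E E' : Finset (Sym2 Z2)} {A : Set Bonds} (hA : IsLocalEvent E A)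
    (h : E ⊆ E') : IsLocalEvent E' A := fun η η' hη => hA η η' fun e he => hη e (h he)

/-- The indicator function of an event, on finite bond configurations. -/
def eventInd (A : Set Bonds) (ω : Finset (Sym2 Z2)) : ℝ := A.indicator 1 (ω : Bonds)

lemma eventInd_congr {A A' : Set Bonds} {ω ω' : Finset (Sym2 Z2)}
    (h : (ω : Bonds) ∈ A ↔ (ω' : Bonds) ∈ A') : eventInd A ω = eventInd A' ω' := by
  by_cases h1 : (ω : Bonds) ∈ A
  · simp [eventInd, h1, h.1 h1]
  · simp [eventInd, h1, h.not.1 h1]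

lemma eventInd_nonneg (A : Set Bonds) : 0 ≤ eventInd A := fun _ =>
  Set.indicator_nonneg (fun _ _ => zero_le_one) _

lemma measurableSet_cylinder (E ω : Finset (Sym2 Z2)) :
    MeasurableSet {η : Bonds | ∀ e ∈ E, e ∈ η ↔ e ∈ ω} := by
  have h : {η : Bonds | ∀ e ∈ E, e ∈ η ↔ e ∈ ω} = ⋂ e ∈ E, {η : Bonds | e ∈ η ↔ e ∈ ω} := by
    ext; simp
  rw [h]
  refine Finset.measurableSet_biInter _ fun e _ => ?_
  have h1 : MeasurableSet {η : Bonds | e ∈ η} := measurableSet_setOfPred.2 (measurable_set_mem e)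
  by_cases he : e ∈ ω
  · simpa [he] using h1
  · have h2 : {η : Bonds | e ∈ η ↔ e ∈ ω} = {η : Bonds | e ∈ η}ᶜ := by ext; simp [he]
    exact h2 ▸ h1.compl

lemma IsLocalEvent.eq_biUnion {E : Finset (Sym2 Z2)} {A : Set Bonds} (hA : IsLocalEvent E A)
    [DecidablePred fun ω : Finset (Sym2 Z2) => (ω : Bonds) ∈ A] :
    A = ⋃ ω ∈ E.powerset.filter fun ω : Finset (Sym2 Z2) => (ω : Bonds) ∈ A,
      {η : Bonds | ∀ e ∈ E, e ∈ η ↔ e ∈ ω} := by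
  classical
  ext η
  simp only [Set.mem_iUnion, Finset.mem_filter, Finset.mem_powerset, exists_prop,
    Set.mem_ofPred_eq]
  constructor
  · intro hη
    refine ⟨E.filter (· ∈ η), ⟨Finset.filter_subset _ _, ?_⟩, fun e he => by simp [he]⟩
    exact (hA η _ fun e he => by simp [he]).1 hη
  · rintro ⟨ω, ⟨_, hω⟩, h⟩
    exact (hA η ω fun e he => by simpa using h e he).2 hω

lemma IsLocalEvent.measurableSet {E : Finset (Sym2 Z2)} {A : Set Bonds}
    (hA : IsLocalEvent E A) : MeasurableSet A := by
  classical
  rw [hA.eq_biUnion]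
  exact Finset.measurableSet_biUnion _ fun ω _ => measurableSet_cylinder E ω

lemma IsLocalEvent.setBernoulli_real {u : Bonds} (p : unitInterval) {E : Finset (Sym2 Z2)}
    {A : Set Bonds} (hA : IsLocalEvent E A) (hE : (E : Bonds) ⊆ u) :
    (setBernoulli u p).real A = ∑ ω ∈ E.powerset, percWeight p E ω * eventInd A ω := by
  classical
  conv_lhs => rw [hA.eq_biUnion]
  rw [measureReal_biUnion_finset, Finset.sum_filter]
  · refine Finset.sum_congr rfl fun ω hω => ?_
    rw [setBernoulli_cylinder p hE (Finset.mem_powerset.1 hω)]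
    by_cases h : (ω : Bonds) ∈ A <;> simp [eventInd, h]
  · intro ω hω ω' hω' hne
    rw [Finset.mem_coe, Finset.mem_filter, Finset.mem_powerset] at hω hω'
    refine Set.disjoint_left.2 fun η h h' => hne ?_
    ext e
    exact ⟨fun he => (h' e (hω.1 he)).1 ((h e (hω.1 he)).2 he),
      fun he => (h e (hω'.1 he)).1 ((h' e (hω'.1 he)).2 he)⟩
  · exact fun ω _ => measurableSet_cylinder E ω

lemma bondsIn_subset_edgeSet (Λ : Finset Z2) : (bondsIn Λ : Bonds) ⊆ lattice.edgeSet := by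
  intro e he
  classical
  simp only [bondsIn, Finset.coe_filter, Set.mem_ofPred_eq] at he
  exact he.2

lemma mk_mem_bondsIn {Λ : Finset Z2} {x y : Z2} :
    s(x, y) ∈ bondsIn Λ ↔ x ∈ Λ ∧ y ∈ Λ ∧ lattice.Adj x y := by
  classical
  simp [bondsIn, and_assoc]

/-- The conditional probability of a local event under the FK measure, given the spins. -/
lemma setBernoulli_agreeing (p : unitInterval) {Λ : Finset Z2} {A : Set Bonds}
    (hA : IsLocalEvent (bondsIn Λ) A) (σ : Spins) :
    (setBernoulli lattice.edgeSet p).real {η | agreeing σ η ∈ A} =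
      ∑ ω ∈ (agreeIn (bondsIn Λ) σ).powerset,
        percWeight p (agreeIn (bondsIn Λ) σ) ω * eventInd A ω := by
  -- Disagreeing bonds are closed by `agreeing`, so only the agreeing ones influence the event.
  have hloc : IsLocalEvent (agreeIn (bondsIn Λ) σ) {η | agreeing σ η ∈ A} := by
    intro η η' h
    refine hA _ _ fun e he => ?_
    simp only [agreeing, Set.mem_ofPred_eq]
    constructor
    · exact fun h1 => ⟨(h e (mem_agreeIn.2 ⟨he, h1.2⟩)).1 h1.1, h1.2⟩
    · exact fun h1 => ⟨(h e (mem_agreeIn.2 ⟨he, h1.2⟩)).2 h1.1, h1.2⟩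
  rw [hloc.setBernoulli_real p
    ((Finset.coe_subset.2 (agreeIn_subset _ σ)).trans (bondsIn_subset_edgeSet Λ))]
  refine Finset.sum_congr rfl fun ω hω => ?_
  rw [Finset.mem_powerset] at hω
  have h1 : agreeing σ (ω : Bonds) = ω :=
    Set.ext fun e => ⟨fun h => h.1, fun h => ⟨h, (mem_agreeIn.1 (hω h)).2⟩⟩
  have h2 : (ω : Bonds) ∈ {η | agreeing σ η ∈ A} ↔ (ω : Bonds) ∈ A := by
    rw [Set.mem_ofPred_eq, h1]
  rw [eventInd_congr h2]

lemma bondSpin_congr {Λ : Finset Z2} {σ τ : Spins} (h : ∀ z ∈ Λ, σ z = τ z) {e : Sym2 Z2}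
    (he : e ∈ bondsIn Λ) : bondSpin σ e = bondSpin τ e := by
  induction e using Sym2.ind with
  | _ x y =>
    have := mk_mem_bondsIn.1 he
    simp [bondSpin_mk, spin, h x this.1, h y this.2.1]

lemma agreeIn_congr {Λ : Finset Z2} {σ τ : Spins} (h : ∀ z ∈ Λ, σ z = τ z) :
    agreeIn (bondsIn Λ) σ = agreeIn (bondsIn Λ) τ := by
  ext e
  simp only [mem_agreeIn]
  exact and_congr_right fun he => by rw [bondSpin_congr h he]

lemma criticalFK_real {A : Set Bonds} (hA : MeasurableSet A) :
    criticalFK.real A =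
      ∫ σ, (setBernoulli lattice.edgeSet pC).real {η | agreeing σ η ∈ A}
        ∂(criticalIsing : Measure Spins) := by
  have hm := measurable_agreeing hA
  rw [measureReal_def, criticalFK, Measure.map_apply measurable_agreeing hA,
    Measure.prod_apply hm]
  rw [← integral_toReal (measurable_measure_prodMk_left hm).aemeasurable
    (Eventually.of_forall fun σ => measure_lt_top _ _)]
  rfl

instance : IsProbabilityMeasure criticalFK :=
  Measure.isProbabilityMeasure_map measurable_agreeing.aemeasurable

lemma pC_lt_one : (pC : ℝ) < 1 := sub_lt_self _ (Real.exp_pos _)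

/-- Given the spins, the probability of a local event depends on finitely many of them, so it is
continuous and weak convergence applies. In a volume containing `Λ₀` its mean is the random-cluster
ratio. -/
lemma tendsto_rcSum_criticalFK {Λ₀ : Finset Z2} {A : Set Bonds}
    (hA : IsLocalEvent (bondsIn Λ₀) A) :
    Tendsto (fun Λ => rcSum pC ∅ (bondsIn Λ) (eventInd A) / rcSum pC ∅ (bondsIn Λ) 1) atTop
      (𝓝 (criticalFK.real A)) := by
  rw [criticalFK_real hA.measurableSet]
  have hcont : Continuous fun σ : Spins =>
      (setBernoulli lattice.edgeSet pC).real {η | agreeing σ η ∈ A} := by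
    simp_rw [setBernoulli_agreeing pC hA]
    exact continuous_of_local Λ₀ fun σ τ h => by rw [agreeIn_congr h]
  refine (tendsto_integral_criticalIsing hcont).congr' ?_
  filter_upwards [eventually_ge_atTop Λ₀] with Λ hΛ
  simp_rw [setBernoulli_agreeing pC (hA.mono (bondsIn_mono hΛ))]
  exact integral_isingFree_perc rfl Λ _

lemma tendsto_rcSum_tau (z : Z2) :
    Tendsto (fun Λ => rcSum pC ∅ (bondsIn Λ) (triv fun σ => spin σ 0 * spin σ z) /
      rcSum pC ∅ (bondsIn Λ) 1) atTop (𝓝 (tau z)) := by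
  have hcont : Continuous fun σ : Spins => spin σ 0 * spin σ z :=
    continuous_of_local {0, z} fun σ τ h => by simp [spin, h 0 (by simp), h z (by simp)]
  refine (tendsto_integral_criticalIsing hcont).congr fun Λ => ?_
  exact integral_isingFree_char rfl Λ ((isSpinChar_spin 0).mul (isSpinChar_spin z))

/-! Connections to the boundary of a finite set of sites. -/

/-- All pairs of boundary sites of `B`. -/
def wiring (B : Finset Z2) : Finset (Sym2 Z2) := by
  classical exact B.sym2.filter fun e => ∀ v ∈ e, v ∈ bdry B

lemma mk_mem_wiring {B : Finset Z2} {x y : Z2} :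
    s(x, y) ∈ wiring B ↔ x ∈ bdry B ∧ y ∈ bdry B := by
  classical
  simp only [wiring, Finset.mem_filter, Finset.mk_mem_sym2_iff, Sym2.mem_iff, forall_eq_or_imp,
    forall_eq]
  exact ⟨fun h => h.2, fun h => ⟨⟨h.1.1, h.2.1⟩, h⟩⟩

/-- The event that `x` is connected to the boundary of `B` within `B`. -/
def bdryEvent (B : Finset Z2) (x : Z2) : Set Bonds :=
  {η | Connects (η ∩ (bondsIn B : Bonds)) x (bdry B)}

lemma Connects.mono {ω η : Bonds} (h : ω ⊆ η) {x : Z2} {A : Set Z2} (hω : Connects ω x A) :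
    Connects η x A := by
  obtain ⟨v, hv, h'⟩ := hω
  exact ⟨v, hv, h'.mono (SimpleGraph.fromEdgeSet_mono h)⟩

lemma isLocalEvent_bdryEvent (B : Finset Z2) (x : Z2) :
    IsLocalEvent (bondsIn B) (bdryEvent B x) := by
  intro η η' h
  have : η ∩ (bondsIn B : Bonds) = η' ∩ (bondsIn B : Bonds) := by
    ext e
    exact and_congr_left fun he => h e he
  simp only [bdryEvent, Set.mem_ofPred_eq, this]

lemma eventInd_bdryEvent_mono (B : Finset Z2) (x : Z2) :
    Monotone (eventInd (bdryEvent B x)) := by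
  intro ω η h
  by_cases hω : (ω : Bonds) ∈ bdryEvent B x
  · have hη : (η : Bonds) ∈ bdryEvent B x :=
      Connects.mono (Set.inter_subset_inter_left _ (Finset.coe_subset.2 h)) hω
    simp [eventInd, hω, hη]
  · simpa [eventInd, hω] using eventInd_nonneg _ η

/-- If two spins are forced to agree, and only one of the two sites is in `B`, then that one is
connected to the boundary of `B`. -/
lemma mem_bdryEvent_of_trivializes {B : Finset Z2} {x y : Z2} (hx : x ∈ B) (hy : y ∉ B)
    {ω : Finset (Sym2 Z2)} (hω : (ω : Bonds) ⊆ lattice.edgeSet)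
    (h : Trivializes (fun σ => spin σ x * spin σ y) ω) : (ω : Bonds) ∈ bdryEvent B x := by
  classical
  by_contra hcon
  let G := SimpleGraph.fromEdgeSet ((ω : Bonds) ∩ (bondsIn B : Bonds))
  have hbd : ∀ v, G.Reachable x v → v ∉ bdry B := fun v hv hv' => hcon ⟨v, hv', hv⟩
  -- Plus on the cluster of `x` in `B`, minus elsewhere. If that cluster misses the boundary, no
  -- open bond leaves it, so `σ` agrees along `ω` while separating `x` from `y`.
  let σ : Spins := fun v => decide (v ∈ B ∧ G.Reachable x v)
  have step : ∀ a b, s(a, b) ∈ ω → (a ∈ B ∧ G.Reachable x a) → b ∈ B ∧ G.Reachable x b := by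
    rintro a b hab ⟨ha, hr⟩
    have hadj : lattice.Adj a b := hω hab
    have hb : b ∈ B := by
      by_contra hb
      exact hbd a hr ⟨ha, b, hb, hadj⟩
    refine ⟨hb, hr.trans (SimpleGraph.Adj.reachable ?_)⟩
    exact (SimpleGraph.fromEdgeSet_adj _).2 ⟨⟨hab, mk_mem_bondsIn.2 ⟨ha, hb, hadj⟩⟩, hadj.ne⟩
  have hσ : σ ∈ agreeSet ω := by
    intro e he
    induction e using Sym2.ind with
    | _ a b =>
      rw [bondSpin_mk_eq_one_iff]
      exact decide_eq_decide.2 ⟨step a b he, step b a (Sym2.eq_swap ▸ he)⟩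
  have h1 := h σ hσ
  have hx' : σ x = true := decide_eq_true ⟨hx, SimpleGraph.Reachable.refl _⟩
  have hy' : σ y = false := decide_eq_false fun h => hy h.1
  simp only [spin, hx', hy'] at h1
  norm_num at h1

/-- Extend the spins in `B` by the common value on the boundary of `B`. -/
lemma exists_agreeSet_extension {B : Finset Z2} {ω η : Finset (Sym2 Z2)} {σ : Spins}
    (hω : ω ⊆ bondsIn B) (hηl : (η : Bonds) ⊆ lattice.edgeSet) (hη : Disjoint η (bondsIn B))
    (hσ : σ ∈ agreeSet (ω ∪ wiring B)) :
    ∃ τ ∈ agreeSet (ω ∪ η ∪ wiring B), ∀ z ∈ B, τ z = σ z := by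
  classical
  obtain ⟨c, hc⟩ : ∃ c, ∀ v ∈ bdry B, σ v = c := by
    by_cases h : (bdry B).Nonempty
    · obtain ⟨w, hw⟩ := h
      refine ⟨σ w, fun v hv => (bondSpin_mk_eq_one_iff σ v w).1 (hσ _ ?_)⟩
      exact Finset.mem_union_right _ (mk_mem_wiring.2 ⟨hv, hw⟩)
    · exact ⟨true, fun v hv => (h ⟨v, hv⟩).elim⟩
  let τ : Spins := fun v => if v ∈ B then σ v else c
  have hτ : ∀ v ∈ B, τ v = σ v := fun v hv => if_pos hv
  refine ⟨τ, fun e he => ?_, hτ⟩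
  rw [Finset.mem_union, Finset.mem_union] at he
  induction e using Sym2.ind with
  | _ a b =>
    rw [bondSpin_mk_eq_one_iff]
    rcases he with (he | he) | he
    · have h1 := mk_mem_bondsIn.1 (hω he)
      rw [hτ a h1.1, hτ b h1.2.1]
      exact (bondSpin_mk_eq_one_iff σ a b).1 (hσ _ (Finset.mem_union_left _ he))
    -- A bond of `η` has at most one end in `B`, and such an end is a boundary site, where the spin
    -- is `c`.
    · have hadj : lattice.Adj a b := hηl he
      have hnot : ¬ (a ∈ B ∧ b ∈ B) := fun h =>
        Finset.disjoint_left.1 hη he (mk_mem_bondsIn.2 ⟨h.1, h.2, hadj⟩)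
      by_cases ha : a ∈ B
      · have hb : b ∉ B := fun hb => hnot ⟨ha, hb⟩
        simp only [τ, ha, hb, if_true, if_false]
        exact hc a ⟨ha, b, hb, hadj⟩
      · by_cases hb : b ∈ B
        · simp only [τ, ha, hb, if_true, if_false]
          exact (hc b ⟨hb, a, ha, hadj.symm⟩).symm
        · simp only [τ, ha, hb, if_false]
    · have h1 := mk_mem_wiring.1 he
      rw [hτ a h1.1.1, hτ b h1.2.1]
      exact (bondSpin_mk_eq_one_iff σ a b).1 (hσ _ (Finset.mem_union_right _ he))

lemma triv_bondSpin_wiring {B : Finset Z2} {ω η : Finset (Sym2 Z2)} (hω : ω ⊆ bondsIn B)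
    (hηl : (η : Bonds) ⊆ lattice.edgeSet) (hη : Disjoint η (bondsIn B)) {e : Sym2 Z2}
    (he : e ∈ bondsIn B) :
    triv (fun σ => bondSpin σ e) (ω ∪ η ∪ wiring B) =
      triv (fun σ => bondSpin σ e) (ω ∪ wiring B) := by
  have h : Trivializes (fun σ => bondSpin σ e) (ω ∪ η ∪ wiring B) ↔
      Trivializes (fun σ => bondSpin σ e) (ω ∪ wiring B) := by
    constructor
    · intro h σ hσ
      obtain ⟨τ, hτ, hτσ⟩ := exists_agreeSet_extension hω hηl hη hσ
      have := h τ hτ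
      exact (bondSpin_congr hτσ he).symm.trans this
    · exact fun h => h.mono (Finset.union_subset_union_left Finset.subset_union_left)
  by_cases h1 : Trivializes (fun σ => bondSpin σ e) (ω ∪ wiring B)
  · rw [triv, triv, if_pos h1, if_pos (h.2 h1)]
  · rw [triv, triv, if_neg h1, if_neg (h.not.2 h1)]

/-- In the presence of the wiring, the bonds outside `B` do not influence those in `B`. -/
lemma mass_wiring_factor {B : Finset Z2} {ω η : Finset (Sym2 Z2)} (hω : ω ⊆ bondsIn B)
    (hηl : (η : Bonds) ⊆ lattice.edgeSet) (hη : Disjoint η (bondsIn B)) :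
    mass (ω ∪ η ∪ wiring B) * mass (wiring B) = mass (ω ∪ wiring B) * mass (η ∪ wiring B) := by
  induction ω using Finset.induction_on with
  | empty => simp [mul_comm]
  | insert e s _ ih =>
    obtain ⟨he, hs⟩ := Finset.insert_subset_iff.1 hω
    -- Adding a bond of `B` multiplies both sides by the same factor, because `η` does not change
    -- which bonds of `B` are forced to agree.
    rw [Finset.insert_union, Finset.insert_union, Finset.insert_union, mass_insert, mass_insert,
      triv_bondSpin_wiring hs hηl hη he]
    linear_combination ((1 + triv (fun σ => bondSpin σ e) (s ∪ wiring B)) / 2) * ih hs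

/-- The two-point function in a finite set is bounded by the product of a wired and a free
connection probability. -/
lemma rcSum_triv_mul_le {p : ℝ} (h0 : 0 ≤ p) (h1 : p < 1) {Λ B₀ B : Finset Z2} {x y : Z2}
    (hBΛ : B ⊆ Λ) (hx : x ∈ B₀) (hxB : x ∉ B) (hy : y ∈ B) (hyB : y ∉ B₀)
    (hdisj : Disjoint (bondsIn B₀) (bondsIn B)) :
    rcSum p ∅ (bondsIn Λ) (triv fun σ => spin σ x * spin σ y) * rcSum p (wiring B) (bondsIn B) 1 ≤
      rcSum p (wiring B) (bondsIn B) (eventInd (bdryEvent B y)) *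
        rcSum p ∅ (bondsIn Λ) (eventInd (bdryEvent B₀ x)) := by
  have hle : rcSum p ∅ (bondsIn Λ) (triv fun σ => spin σ x * spin σ y) ≤
      rcSum p ∅ (bondsIn Λ) (eventInd (bdryEvent B y) * eventInd (bdryEvent B₀ x)) := by
    refine rcSum_mono h0 h1 fun ω hω => ?_
    by_cases h : Trivializes (fun σ => spin σ x * spin σ y) ω
    · have hl := (Finset.coe_subset.2 hω).trans (bondsIn_subset_edgeSet Λ)
      have h2 := mem_bdryEvent_of_trivializes hx hyB hl h
      have h3 := mem_bdryEvent_of_trivializes hy hxB hl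
        (by simpa only [mul_comm] using h)
      simp [triv, h, eventInd, h2, h3]
    · simpa [triv, h] using mul_nonneg (eventInd_nonneg (bdryEvent B y) ω)
        (eventInd_nonneg (bdryEvent B₀ x) ω)
  refine (mul_le_mul_of_nonneg_right hle (rcSum_one_pos h0 h1 _ _).le).trans ?_
  -- The event at `y` lives on the bonds of `B`; the event at `x` lives on the remaining ones, by
  -- `hdisj`.
  have hsplit : bondsIn Λ = bondsIn B ∪ (bondsIn Λ \ bondsIn B) :=
    (Finset.union_sdiff_of_subset (bondsIn_mono hBΛ)).symm
  rw [hsplit]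
  have hηd : ∀ η ⊆ bondsIn Λ \ bondsIn B, Disjoint η (bondsIn B) := fun η hη =>
    Finset.sdiff_disjoint.mono_left hη
  refine rcSum_mul_le_wired h0 h1 Finset.disjoint_sdiff ?_ (eventInd_nonneg _)
    (eventInd_nonneg _) (eventInd_bdryEvent_mono B y) ?_ ?_
  · intro η hη ω hω
    have hηl : (η : Bonds) ⊆ lattice.edgeSet :=
      (Finset.coe_subset.2 (hη.trans Finset.sdiff_subset)).trans (bondsIn_subset_edgeSet Λ)
    rw [Finset.union_comm (wiring B), Finset.union_comm (wiring B)]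
    exact mass_wiring_factor hω hηl (hηd η hη)
  · intro η hη ω hω
    have := isLocalEvent_bdryEvent B y ((ω ∪ η : Finset _) : Bonds) ω fun e he => by
      have := Finset.disjoint_right.1 (hηd η hη) he
      simp [this]
    exact eventInd_congr this
  · intro η hη ω hω
    have := isLocalEvent_bdryEvent B₀ x ((ω ∪ η : Finset _) : Bonds) η fun e he => by
      have : e ∉ ω := fun h => Finset.disjoint_left.1 hdisj he (hω h)
      simp [this]
    exact eventInd_congr this

/-! The cluster weight in terms of `mass`. -/

lemma fairSpins_real_restrict (B : Finset Z2) (s : B → Bool) :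
    fairSpins.real (B.restrict ⁻¹' {s}) = (1 / 2) ^ B.card := by
  classical
  have h1 : (B.restrict ⁻¹' {s} : Set Spins) =
      (B : Set Z2).pi fun z => if hz : z ∈ B then {s ⟨z, hz⟩} else Set.univ := by
    ext σ
    simp only [Set.mem_preimage, Set.mem_singleton_iff, Set.mem_pi, Finset.mem_coe]
    constructor
    · rintro rfl z hz
      simp [hz]
    · intro h
      funext z
      simpa [z.2] using h z z.2
  rw [h1, measureReal_def, fairSpins, Measure.infinitePi_pi _ fun _ _ => MeasurableSet.of_discrete,
    ENNReal.toReal_prod]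
  refine Finset.prod_eq_pow_card fun z hz => ?_
  simp only [hz, dite_true]
  rw [← measureReal_def, bernoulliMeasure_real_apply _ (measurableSet_singleton _)]
  cases s ⟨z, hz⟩ <;> simp
  norm_num

/-- Functions that are constant along the edges of a graph are functions of the component. -/
def constantEquiv {V : Type*} (G : SimpleGraph V) :
    {s : V → Bool // ∀ a b, G.Adj a b → s a = s b} ≃ (G.ConnectedComponent → Bool) where
  toFun s := fun c => c.lift s.1 fun v w p hp => by
    clear hp
    induction p with
    | nil => rfl
    | cons h _ ih => exact (s.2 _ _ h).trans ih
  invFun f := ⟨fun v => f (G.connectedComponentMk v), fun _ _ h =>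
    congrArg f (SimpleGraph.ConnectedComponent.eq.2 h.reachable)⟩
  left_inv s := rfl
  right_inv f := by
    funext c
    induction c using SimpleGraph.ConnectedComponent.ind with
    | _ v => rfl

/-- Both sides count the spin configurations on `B` that are constant on clusters: there are two
choices per cluster, and each configuration has probability `2 ^ (-|B|)`. -/
lemma two_pow_clusters (B : Finset Z2) {H : Finset (Sym2 Z2)}
    (hH : ∀ e ∈ H, ∀ v ∈ e, v ∈ B) :
    (2 : ℝ) ^ Nat.card
        ((SimpleGraph.fromEdgeSet (H : Set (Sym2 Z2))).induce (B : Set Z2)).ConnectedComponent =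
      2 ^ B.card * mass H := by
  classical
  set G := (SimpleGraph.fromEdgeSet (H : Set (Sym2 Z2))).induce (B : Set Z2) with hG
  have : Finite G.ConnectedComponent := Quot.finite _
  let S : Finset (B → Bool) := Finset.univ.filter fun s => ∀ a b : B, G.Adj a b → s a = s b
  have hcard : S.card = 2 ^ Nat.card G.ConnectedComponent := by
    have h1 : Nat.card {s : B → Bool // ∀ a b : B, G.Adj a b → s a = s b} = S.card := by
      rw [Nat.card_eq_fintype_card, Fintype.card_subtype]
    refine (h1.symm.trans (Nat.card_congr (constantEquiv G))).trans ?_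
    rw [Nat.card_fun]
    simp
  have hset : agreeSet H = ⋃ s ∈ S, (B.restrict ⁻¹' {s} : Set Spins) := by
    ext σ
    simp only [Set.mem_iUnion, Set.mem_preimage, Set.mem_singleton_iff, exists_prop,
      exists_eq_right', S, Finset.mem_filter, Finset.mem_univ, true_and]
    constructor
    · intro h a b hab
      have hab' := (SimpleGraph.fromEdgeSet_adj _).1 (SimpleGraph.induce_adj.1 hab)
      exact (bondSpin_mk_eq_one_iff σ a b).1 (h _ hab'.1)
    · intro h e he
      induction e using Sym2.ind with
      | _ x y =>
        rw [bondSpin_mk_eq_one_iff]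
        -- `H` may contain diagonal pairs, as `wiring` does. They are not edges of the graph, and
        -- agreement along them is automatic.
        by_cases hxy : x = y
        · rw [hxy]
        · exact h ⟨x, hH _ he x (by simp)⟩ ⟨y, hH _ he y (by simp)⟩
            (SimpleGraph.induce_adj.2 ((SimpleGraph.fromEdgeSet_adj _).2 ⟨he, hxy⟩))
  have hmass : mass H = S.card * (1 / 2) ^ B.card := by
    rw [mass, hset, measureReal_biUnion_finset]
    · simp [fairSpins_real_restrict]
    · intro s _ t _ hst
      exact Set.disjoint_left.2 fun σ h h' => hst (h.symm.trans h')
    · exact fun s _ => (Finset.measurable_restrict B) (measurableSet_singleton s)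
  rw [hmass, hcard]
  push_cast
  rw [mul_left_comm, ← mul_pow]
  norm_num

/-- The factor `2 ^ B.card` does not depend on `ω` and cancels in probabilities. -/
lemma wiredWeight_eq {B : Finset Z2} {ω : Finset (Sym2 Z2)} (hω : ω ⊆ bondsIn B) :
    wiredWeight B ω = 2 ^ B.card * rcWeight pC (wiring B) (bondsIn B) ω := by
  have h1 : (ω : Set (Sym2 Z2)) ∪ {e | ∀ v ∈ e, v ∈ bdry B} =
      ((ω ∪ wiring B : Finset (Sym2 Z2)) : Set (Sym2 Z2)) := by
    ext e
    induction e using Sym2.ind with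
    | _ x y => simp [mk_mem_wiring, -Prod.forall]
  have h2 : (2 : ℝ) ^ wiredClusters B ω = 2 ^ B.card * mass (ω ∪ wiring B) := by
    rw [wiredClusters, h1]
    refine two_pow_clusters B fun e he => ?_
    induction e using Sym2.ind with
    | _ x y =>
      rcases Finset.mem_union.1 he with h | h
      · have := mk_mem_bondsIn.1 (hω h)
        simp [this.1, this.2.1]
      · have := mk_mem_wiring.1 h
        simp [this.1.1, this.2.1]
  rw [wiredWeight, h2, rcWeight, percWeight]
  ring_nf

lemma sum_wiredWeight (B : Finset Z2) :
    ∑ ω ∈ (bondsIn B).powerset, wiredWeight B ω =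
      2 ^ B.card * rcSum pC (wiring B) (bondsIn B) 1 := by
  rw [rcSum, Finset.mul_sum]
  refine Finset.sum_congr rfl fun ω hω => ?_
  rw [wiredWeight_eq (Finset.mem_powerset.1 hω), Pi.one_apply, mul_one]

lemma wiredProb_connects (B : Finset Z2) (x : Z2) :
    wiredProb B {ω | Connects ω x (bdry B)} =
      rcSum pC (wiring B) (bondsIn B) (eventInd (bdryEvent B x)) /
        rcSum pC (wiring B) (bondsIn B) 1 := by
  classical
  have h2 : ∑ ω ∈ (bondsIn B).powerset.filter
        (fun ω : Finset (Sym2 Z2) => (ω : Set (Sym2 Z2)) ∈ {ω | Connects ω x (bdry B)}),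
        wiredWeight B ω =
      2 ^ B.card * rcSum pC (wiring B) (bondsIn B) (eventInd (bdryEvent B x)) := by
    rw [rcSum, Finset.mul_sum, Finset.sum_filter]
    refine Finset.sum_congr rfl fun ω hω => ?_
    rw [Finset.mem_powerset] at hω
    have h3 : (ω : Bonds) ∈ bdryEvent B x ↔ Connects (ω : Bonds) x (bdry B) := by
      rw [bdryEvent, Set.mem_ofPred_eq, Set.inter_eq_left.2 (Finset.coe_subset.2 hω)]
    rw [wiredWeight_eq hω]
    by_cases h : Connects (ω : Bonds) x (bdry B)
    · simp [h, eventInd, h3.2 h]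
    · simp [h, eventInd, h3.not.2 h]
  rw [wiredProb, sum_wiredWeight]
  refine Eq.trans ?_ (mul_div_mul_left _ _ (pow_ne_zero B.card (two_ne_zero (α := ℝ))))
  rw [← h2]

/-! Automorphisms of the lattice. -/

/-- The action of a permutation of the sites on pairs of sites. -/
abbrev pairMap (T : Z2 ≃ Z2) : Sym2 Z2 ↪ Sym2 Z2 := T.toEmbedding.sym2Map

lemma mk_mem_map_pairMap (T : Z2 ≃ Z2) (X : Finset (Sym2 Z2)) (x y : Z2) :
    s(T x, T y) ∈ X.map (pairMap T) ↔ s(x, y) ∈ X :=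
  Finset.mem_map' (pairMap T) (a := s(x, y))

lemma finset_sym2_ext_of_equiv (T : Z2 ≃ Z2) {X Y : Finset (Sym2 Z2)}
    (h : ∀ x y, s(T x, T y) ∈ X ↔ s(T x, T y) ∈ Y) : X = Y := by
  ext e
  induction e using Sym2.ind with
  | _ x y => simpa using h (T.symm x) (T.symm y)

lemma mass_map (T : Z2 ≃ Z2) (ω : Finset (Sym2 Z2)) : mass (ω.map (pairMap T)) = mass ω := by
  have h1 : agreeSet (ω.map (pairMap T)) =
      (fun (σ : Spins) z => σ (T z)) ⁻¹' agreeSet ω := by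
    ext σ
    simp only [mem_agreeSet, Finset.forall_mem_map, Set.mem_preimage]
    refine forall₂_congr fun e _ => ?_
    induction e using Sym2.ind with
    | _ x y => rfl
  have hm : Measurable fun (σ : Spins) z => σ (T z) :=
    measurable_pi_lambda _ fun z => measurable_pi_apply _
  rw [mass, mass, measureReal_def, h1, ← Measure.map_apply hm (measurableSet_agreeSet ω),
    fairSpins_map_comp, ← measureReal_def]

variable {T : Z2 ≃ Z2}

lemma bondsIn_map (hT : ∀ a b, lattice.Adj (T a) (T b) ↔ lattice.Adj a b) (B : Finset Z2) :
    bondsIn (B.map T.toEmbedding) = (bondsIn B).map (pairMap T) :=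
  finset_sym2_ext_of_equiv T fun x y => by
    rw [mk_mem_map_pairMap, mk_mem_bondsIn, mk_mem_bondsIn, hT]
    simp

lemma apply_mem_bdry_map (hT : ∀ a b, lattice.Adj (T a) (T b) ↔ lattice.Adj a b) (B : Finset Z2)
    (v : Z2) : T v ∈ bdry (B.map T.toEmbedding) ↔ v ∈ bdry B := by
  simp only [bdry, Set.mem_ofPred_eq]
  refine and_congr (by simp) ?_
  rw [← T.exists_congr_right]
  simp [hT]

lemma wiring_map (hT : ∀ a b, lattice.Adj (T a) (T b) ↔ lattice.Adj a b) (B : Finset Z2) :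
    wiring (B.map T.toEmbedding) = (wiring B).map (pairMap T) :=
  finset_sym2_ext_of_equiv T fun x y => by
    rw [mk_mem_map_pairMap, mk_mem_wiring, mk_mem_wiring, apply_mem_bdry_map hT,
      apply_mem_bdry_map hT]

lemma connects_map (H : Finset (Sym2 Z2)) (x : Z2) {A A' : Set Z2}
    (hA : ∀ v, T v ∈ A' ↔ v ∈ A) :
    Connects (H.map (pairMap T) : Finset _) (T x) A' ↔ Connects (H : Bonds) x A := by
  let φ : SimpleGraph.fromEdgeSet (H : Bonds) ≃g
      SimpleGraph.fromEdgeSet ((H.map (pairMap T) : Finset _) : Bonds) :=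
    { toEquiv := T
      map_rel_iff' := fun {a b} => by
        rw [SimpleGraph.fromEdgeSet_adj, SimpleGraph.fromEdgeSet_adj, Finset.mem_coe,
          mk_mem_map_pairMap, Finset.mem_coe, T.injective.ne_iff] }
  unfold Connects
  rw [← T.exists_congr_right]
  refine exists_congr fun v => and_congr (hA v) ?_
  exact φ.reachable_iff

lemma eventInd_bdryEvent_map (hT : ∀ a b, lattice.Adj (T a) (T b) ↔ lattice.Adj a b)
    (B : Finset Z2) (x : Z2) (ω : Finset (Sym2 Z2)) :
    eventInd (bdryEvent (B.map T.toEmbedding) (T x)) (ω.map (pairMap T)) =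
      eventInd (bdryEvent B x) ω := by
  refine eventInd_congr ?_
  simp only [bdryEvent, Set.mem_ofPred_eq, bondsIn_map hT]
  rw [← Finset.coe_inter, ← Finset.coe_inter, ← Finset.map_inter]
  exact connects_map _ x (apply_mem_bdry_map hT B)

lemma rcSum_map (p : ℝ) (T : Z2 ≃ Z2) (W E : Finset (Sym2 Z2)) (f : Finset (Sym2 Z2) → ℝ) :
    rcSum p (W.map (pairMap T)) (E.map (pairMap T)) f =
      rcSum p W E fun ω => f (ω.map (pairMap T)) := by
  symm
  refine Finset.sum_nbij (fun ω => ω.map (pairMap T)) (fun ω hω => ?_)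
    (Finset.map_injective _).injOn (fun ω hω => ?_) fun ω _ => ?_
  · exact Finset.mem_powerset.2 (Finset.map_subset_map.2 (Finset.mem_powerset.1 hω))
  · obtain ⟨η, hη, rfl⟩ := Finset.subset_map_iff.1 (Finset.mem_powerset.1 hω)
    exact ⟨η, Finset.mem_powerset.2 hη, rfl⟩
  simp only [rcWeight, percWeight]
  rw [← Finset.map_sdiff, ← Finset.map_union, mass_map, Finset.card_map, Finset.card_map]

/-! The bound on the critical two-point function. -/

lemma mem_disc {r : ℝ} {v : Z2} : v ∈ disc r ↔ eNorm v ≤ r := by simp [disc]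

lemma eNorm_sq (v : Z2) : eNorm v ^ 2 = (v.1 : ℝ) ^ 2 + (v.2 : ℝ) ^ 2 :=
  Real.sq_sqrt (by positivity)

lemma eNorm_nonneg (v : Z2) : 0 ≤ eNorm v := Real.sqrt_nonneg _

lemma eNorm_sub_comm (x y : Z2) : eNorm (x - y) = eNorm (y - x) := by
  simp only [eNorm, Prod.fst_sub, Prod.snd_sub]
  congr 1
  push_cast
  ring

lemma eNorm_zero : eNorm 0 = 0 := by simp [eNorm]

lemma eNorm_pos {z : Z2} (hz : z ≠ 0) : 0 < eNorm z := by
  refine Real.sqrt_pos.2 ?_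
  by_contra h
  have h1 : (z.1 : ℝ) = 0 := by nlinarith [sq_nonneg (z.1 : ℝ), sq_nonneg (z.2 : ℝ)]
  have h2 : (z.2 : ℝ) = 0 := by nlinarith [sq_nonneg (z.1 : ℝ), sq_nonneg (z.2 : ℝ)]
  exact hz (Prod.ext (by exact_mod_cast h1) (by exact_mod_cast h2))

lemma lattice_adj_add_right (z a b : Z2) : lattice.Adj (a + z) (b + z) ↔ lattice.Adj a b := by
  simp [lattice]

lemma mem_map_addRight {B : Finset Z2} {z v : Z2} :
    v ∈ B.map (Equiv.addRight z).toEmbedding ↔ v - z ∈ B := by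
  simp [Finset.mem_map_equiv, sub_eq_add_neg]

lemma disjoint_disc_translate {z : Z2} (hz : z ≠ 0) :
    Disjoint (disc (eNorm z / 3)) ((disc (eNorm z / 3)).map (Equiv.addRight z).toEmbedding) := by
  refine Finset.disjoint_left.2 fun v h1 h2 => ?_
  rw [mem_disc] at h1
  rw [mem_map_addRight, mem_disc] at h2
  have h3 := pow_le_pow_left₀ (eNorm_nonneg v) h1 2
  have h4 := pow_le_pow_left₀ (eNorm_nonneg (v - z)) h2 2
  have h5 := pow_pos (eNorm_pos hz) 2
  rw [eNorm_sq, div_pow] at h3 h4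
  simp only [Prod.fst_sub, Prod.snd_sub, Int.cast_sub] at h4
  rw [eNorm_sq] at h3 h4 h5
  -- By the parallelogram law `2|v|² + 2|v - z|² = |2v - z|² + |z|² ≥ |z|²`, whereas both distances
  -- being at most `|z| / 3` bounds the left side by `4|z|² / 9`.
  nlinarith [sq_nonneg (2 * (v.1 : ℝ) - z.1), sq_nonneg (2 * (v.2 : ℝ) - z.2)]

lemma disjoint_bondsIn {B B' : Finset Z2} (h : Disjoint B B') :
    Disjoint (bondsIn B) (bondsIn B') := by
  refine Finset.disjoint_left.2 fun e he he' => ?_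
  induction e using Sym2.ind with
  | _ x y => exact Finset.disjoint_left.1 h (mk_mem_bondsIn.1 he).1 (mk_mem_bondsIn.1 he').1

/-- Paths were confined to `B` to make the event local; this inclusion suffices to return to the
unrestricted event in an upper bound. -/
lemma bdryEvent_subset (B : Finset Z2) (x : Z2) : bdryEvent B x ⊆ {ω | Connects ω x (bdry B)} :=
  fun _ hη => Connects.mono Set.inter_subset_left hη

/-- The bound on the critical two-point function at a nonzero displacement. -/
lemma tau_le {z : Z2} (hz : z ≠ 0) :
    tau z ≤ wiredProb (disc (eNorm z / 3)) (zeroToBdry (eNorm z / 3)) *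
      criticalFK.real (zeroToBdry (eNorm z / 3)) := by
  set B₀ := disc (eNorm z / 3) with hB₀
  let T : Z2 ≃ Z2 := Equiv.addRight z
  have hT : ∀ a b, lattice.Adj (T a) (T b) ↔ lattice.Adj a b := lattice_adj_add_right z
  set B := B₀.map T.toEmbedding with hB
  have hT0 : T 0 = z := zero_add z
  have hdisj : Disjoint B₀ B := disjoint_disc_translate hz
  have h0 : (0 : Z2) ∈ B₀ := mem_disc.2 (by rw [eNorm_zero]; have := eNorm_pos hz; positivity)
  have hzB : z ∈ B := hT0 ▸ Finset.mem_map_of_mem T.toEmbedding h0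
  -- The wired probability, stated about the origin, is moved to the disc about `z` by translation.
  have hW : wiredProb B₀ (zeroToBdry (eNorm z / 3)) =
      rcSum pC (wiring B) (bondsIn B) (eventInd (bdryEvent B z)) /
        rcSum pC (wiring B) (bondsIn B) 1 := by
    have h1 := wiredProb_connects B₀ 0
    have h2 : rcSum pC (wiring B) (bondsIn B) (eventInd (bdryEvent B z)) =
        rcSum pC (wiring B₀) (bondsIn B₀) (eventInd (bdryEvent B₀ 0)) := by
      rw [hB, wiring_map hT, bondsIn_map hT, rcSum_map]
      congr 1
      funext ω
      have h4 := eventInd_bdryEvent_map hT B₀ 0 ω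
      rwa [hT0] at h4
    have h3 : rcSum pC (wiring B) (bondsIn B) 1 = rcSum pC (wiring B₀) (bondsIn B₀) 1 := by
      rw [hB, wiring_map hT, bondsIn_map hT, rcSum_map]
      rfl
    rw [h2, h3]
    exact h1
  have hp0 : (0 : ℝ) ≤ pC := pC.2.1
  have hWpos := rcSum_one_pos hp0 pC_lt_one (wiring B) (bondsIn B)
  have hW0 : 0 ≤ wiredProb B₀ (zeroToBdry (eNorm z / 3)) := by
    rw [hW]
    refine div_nonneg (Finset.sum_nonneg fun ω _ => ?_) hWpos.le
    exact mul_nonneg (rcWeight_nonneg hp0 pC_lt_one _ _ _) (eventInd_nonneg _ _)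
  have hlim : tau z ≤ wiredProb B₀ (zeroToBdry (eNorm z / 3)) *
      criticalFK.real (bdryEvent B₀ 0) := by
    refine le_of_tendsto_of_tendsto (tendsto_rcSum_tau z)
      ((tendsto_rcSum_criticalFK (isLocalEvent_bdryEvent B₀ 0)).const_mul _) ?_
    filter_upwards [eventually_ge_atTop B] with Λ hΛ
    have key := rcSum_triv_mul_le hp0 pC_lt_one hΛ h0 (Finset.disjoint_left.1 hdisj h0) hzB
      (Finset.disjoint_right.1 hdisj hzB) (disjoint_bondsIn hdisj)
    rw [hW, ← mul_div_assoc]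
    refine div_le_div_of_nonneg_right ?_ (rcSum_one_pos hp0 pC_lt_one _ _).le
    rw [div_mul_eq_mul_div, le_div_iff₀ hWpos]
    exact key
  exact hlim.trans (mul_le_mul_of_nonneg_left (measureReal_mono (bdryEvent_subset B₀ 0)) hW0)

lemma tau_zero_le_one : tau 0 ≤ 1 :=
  (abs_le.1 (abs_integral_char_le ((isSpinChar_spin 0).mul (isSpinChar_spin 0)) _)).2

lemma zero_mem_bdry_disc_zero : (0 : Z2) ∈ bdry (disc 0) := by
  refine ⟨mem_disc.2 eNorm_zero.le, (1, 0), fun h => ?_, by simp [lattice]⟩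
  have := mem_disc.1 h
  simp [eNorm] at this
  linarith

lemma zeroToBdry_zero : zeroToBdry 0 = Set.univ :=
  Set.eq_univ_of_forall fun _ => ⟨0, zero_mem_bdry_disc_zero, SimpleGraph.Reachable.refl _⟩

lemma wiredProb_univ (B : Finset Z2) : wiredProb B Set.univ = 1 := by
  classical
  have h1 : 0 < ∑ ω ∈ (bondsIn B).powerset, wiredWeight B ω := by
    have h := rcSum_one_pos pC.2.1 pC_lt_one (wiring B) (bondsIn B)
    rw [sum_wiredWeight]
    positivity
  rw [wiredProb]
  simp only [Set.mem_univ, Finset.filter_true]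
  exact div_self h1.ne'

end

end IsingFK

theorem lemma1 :
    Tendsto (IsingFK.isingFree IsingFK.betaC) atTop (𝓝 IsingFK.criticalIsing) ∧
    ∀ x y : ℤ × ℤ,
      IsingFK.tau (y - x) ≤
        IsingFK.wiredProb (IsingFK.disc (IsingFK.eNorm (x - y) / 3))
            (IsingFK.zeroToBdry (IsingFK.eNorm (x - y) / 3)) *
          IsingFK.criticalFK.real (IsingFK.zeroToBdry (IsingFK.eNorm (x - y) / 3)) := by
  refine ⟨IsingFK.tendsto_criticalIsing, fun x y => ?_⟩
  rw [IsingFK.eNorm_sub_comm]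
  -- For `x = y` the two discs coincide and the argument fails. But then `r = 0`, the origin is
  -- itself a boundary site, and the right side is `1`.
  by_cases hz : y - x = 0
  · rw [hz, IsingFK.eNorm_zero, zero_div, IsingFK.zeroToBdry_zero, IsingFK.wiredProb_univ]
    simpa using IsingFK.tau_zero_le_one
  · exact IsingFK.tau_le hz
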